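/- Perturbation of direct illumination. Let $\mathcal O\subset\mathbb R^3$ be a compact triangulated object: $\partial\mathcal O=\bigcup_{i=1}^N\Delta_i$ is a finite union of non-degenerate closed triangles; any two distinct triangles are disjoint or intersect exactly in a vertex or an edge of the triangulation; and each $\Delta_i$ has an outward unit normal $\mathbf n_i$, in the sense that near every point $\mathbf x$ of the relative interior of $\Delta_i$ the set $\mathcal O$ coincides with the half-space $\{\mathbf y:\langle\mathbf n_i,\mathbf y-\mathbf x\rangle\le 0\}$. Let $\Phi=\bigcup_i\operatorname{relint}\Delta_i$, let $\mathbf n(\mathbf x)=\mathbf n_i$ for $\mathbf x\in\operatorname{relint}\Delta_i$, and let $\mu$ be the surface (area) measure on $\partial\mathcal O$, carried by $\Phi$. Let the albedo $\rho:\partial\mathcal O\to(0,1]$ be $\mu$-measurable and put $\rho_\star=\sup_{\partial\mathcal O}\rho$. For $\mathbf x\in\partial\mathcal O$ and $\mathbf u\in\mathbb S^2$ let $\nu(\mathbf x,\mathbf u)=1$ if $\{\mathbf x+t\mathbf u:t\ge 0\}\cap\mathcal O=\{\mathbf x\}$ and $\nu(\mathbf x,\mathbf u)=0$ otherwise, and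 let $$\bar{\mathcal D}[\mathbf u](\mathbf x)=\rho(\mathbf x)\,\max\{\langle\mathbf n(\mathbf x),\mathbf u\rangle,0\}\,\nu(\mathbf x,\mathbf u)\ \text{ for }\mathbf x\in\Phi,\qquad \bar{\mathcal D}[\mathbf u](\mathbf x)=0\ \text{ for }\mathbf x\in\partial\mathcal O\setminus\Phi.$$ Let $S[\mathbf u]=\{\mathbf x\in\partial\mathcal O:\bar{\mathcal D}[\mathbf u](\mathbf x)=0\}$ be the shadowed region and $C[\mathbf u]$ the set of points of $\Phi$ that lie on the boundary of $S[\mathbf u]$ relative to $\partial\mathcal O$. For $\mathbf x\in\partial\mathcal O$ let $t^\star(\mathbf x,\mathbf u)=\inf\{t>0:\mathbf x+t\mathbf u\in\partial\mathcal O\}$, let $\chi[\mathbf u]=\{\mathbf x+t^\star(\mathbf x,\mathbf u)\,\mathbf u:\mathbf x\in C[\mathbf u],\ t^\star(\mathbf x,\mathbf u)<\infty\}$ be the set of shadow-casting edge points, and let $\chi_\star=\sup_{\mathbf u\in\mathbb S^2}\operatorname{length}(\chi[\mathbf u])$, where length is one-dimensional Hausdorff measure. Then $\chi_\star<\infty$,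 and for all $\mathbf u,\mathbf u'\in\mathbb S^2$ with $\|\mathbf u-\mathbf u'\|_2\le\sqrt2$ the functions $\bar{\mathcal D}[\mathbf u]$ and $\bar{\mathcal D}[\mathbf u']$ belong to $L^2(\mu)$ and $$\|\bar{\mathcal D}[\mathbf u]-\bar{\mathcal D}[\mathbf u']\|_{L^2(\mu)}^2\le 2\rho_\star^2\operatorname{area}(\partial\mathcal O)\,\|\mathbf u-\mathbf u'\|_2^2+32\sqrt2\,\rho_\star^2\operatorname{diam}(\mathcal O)\,\chi_\star\,\|\mathbf u-\mathbf u'\|_2 .$$ If moreover $\mathcal O$ is convex, then $$\|\bar{\mathcal D}[\mathbf u]-\bar{\mathcal D}[\mathbf u']\|_{L^2(\mu)}^2\le\rho_\star^2\operatorname{area}(\partial\mathcal O)\,\|\mathbf u-\mathbf u'\|_2^2 .$$ -/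

import Mathlib

open MeasureTheory
open scoped RealInnerProductSpace ENNReal

/-- Euclidean three-space. -/
abbrev E3 : Type := EuclideanSpace ℝ (Fin 3)

/-- A triangulation, by oriented triangles, of the boundary of `O ⊆ ℝ³`. -/
structure Triangulation (O : Set E3) where
  /-- The number of faces. -/
  N : ℕ
  /-- `vert i k` is the `k`-th vertex of the `i`-th face. -/
  vert : Fin N → Fin 3 → E3
  /-- `normal i` is the outward normal of the `i`-th face. -/
  normal : Fin N → E3
  /-- Every face is two-dimensional. -/
  affineIndependent_vert : ∀ i, AffineIndependent ℝ (vert i)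
  /-- The boundary is the union of the faces. -/
  frontier_eq : frontier O = ⋃ i, convexHull ℝ (Set.range (vert i))
  /-- Two distinct faces are disjoint or meet in a vertex or in an edge. -/
  inter_mem : ∀ i j, i ≠ j →
    convexHull ℝ (Set.range (vert i)) ∩ convexHull ℝ (Set.range (vert j)) ∈
      ({∅} ∪ {s | ∃ l k, s = {vert l k}} ∪
        {s | ∃ l k₁ k₂, k₁ ≠ k₂ ∧ s = convexHull ℝ {vert l k₁, vert l k₂}} : Set (Set E3))
  norm_normal : ∀ i, ‖normal i‖ = 1
  normal_orthogonal : ∀ i k l, ⟪normal i, vert i k - vert i l⟫ = 0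
  /-- Around each point of the relative interior of the `i`-th face, `O` is the half-space
  behind the face, so that `normal i` points out of `O` and `- normal i` into `O`. -/
  outward : ∀ i, ∀ x ∈ intrinsicInterior ℝ (convexHull ℝ (Set.range (vert i))),
    ∃ ε > 0, ∀ y ∈ Metric.ball x ε, y ∈ O ↔ ⟪normal i, y - x⟫ ≤ 0

namespace Triangulation

variable {O : Set E3} (T : Triangulation O)

/-- The `i`-th face, a closed triangle. -/
def face (i : Fin T.N) : Set E3 := convexHull ℝ (Set.range (T.vert i))

/-- The relative interior of the `i`-th face. -/
def relInt (i : Fin T.N) : Set E3 := intrinsicInterior ℝ (T.face i)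

/-- `Φ`, the union of the relative interiors of the faces. -/
def regularPart : Set E3 := ⋃ i, T.relInt i

open Classical in
/-- The outward normal `n(x)` at a point `x ∈ Φ` (and `0` elsewhere): the normal of the face whose
relative interior contains `x`. The relative interiors of distinct faces are disjoint. -/
noncomputable def normalAt (x : E3) : E3 :=
  if h : ∃ i, x ∈ T.relInt i then T.normal h.choose else 0

/-- The isometry `w ↦ v₀ + B w` of the plane onto the affine span of the `i`-th face, where the
columns of `B` are the orthonormal basis of `span {v₁ - v₀, v₂ - v₀}` given by Gram-Schmidt. -/
noncomputable def chart (i : Fin T.N) (w : EuclideanSpace ℝ (Fin 2)) : E3 :=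
  T.vert i 0 + ∑ k, w k • InnerProductSpace.gramSchmidtNormed ℝ
    ![T.vert i 1 - T.vert i 0, T.vert i 2 - T.vert i 0] k

/-- The surface measure on the boundary: Lebesgue measure of the plane, transported to the relative
interior of each face by the isometric chart, and summed over the faces. -/
noncomputable def surfaceMeasure : Measure E3 :=
  ∑ i, Measure.map (T.chart i) (volume.restrict (T.chart i ⁻¹' T.relInt i))

/-- The area of the boundary. -/
noncomputable def area : ℝ := (T.surfaceMeasure (frontier O)).toReal

end Triangulation

open Classical in
/-- The point-direction visibility indicator: `1` if the ray from `x` in direction `u` meets `O`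
only in `x`, and `0` otherwise. -/
noncomputable def visibility (O : Set E3) (x u : E3) : ℝ :=
  if {y | ∃ t : ℝ, 0 ≤ t ∧ y = x + t • u} ∩ O = {x} then 1 else 0

/-- The maximum albedo: the supremum of `ρ` over the boundary. -/
noncomputable def maxAlbedo (O : Set E3) (ρ : E3 → ℝ) : ℝ := sSup (ρ '' frontier O)

/-- The shadow retraction relation: `y = x + t⋆ u`, where `t⋆ = inf {t > 0 | x + t u ∈ ∂O}` is
finite (that is, where the set is nonempty). -/
def IsShadowRetraction (O : Set E3) (u x y : E3) : Prop :=
  {t : ℝ | 0 < t ∧ x + t • u ∈ frontier O}.Nonempty ∧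
    y = x + sInf {t : ℝ | 0 < t ∧ x + t • u ∈ frontier O} • u

/-- The boundary of `S` relative to the subspace `X`. -/
def relBoundary (X S : Set E3) : Set E3 :=
  Subtype.val '' frontier (Subtype.val ⁻¹' S : Set X)

namespace Triangulation

variable {O : Set E3} (T : Triangulation O) (ρ : E3 → ℝ)

open Classical in
/-- The direct reflectance under point illumination from direction `u`:
`ρ(x) ⟨n(x), u⟩₊ ν(x, u)` for `x ∈ Φ`, and `0` elsewhere. -/
noncomputable def direct (u x : E3) : ℝ :=
  if x ∈ T.regularPart then ρ x * max ⟪T.normalAt x, u⟫ 0 * visibility O x u else 0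

/-- The shadowed region `S[u]`: the points of the boundary where the direct reflectance
vanishes. -/
def shadow (u : E3) : Set E3 := {x | x ∈ frontier O ∧ T.direct ρ u x = 0}

/-- `C[u]`: the points of `Φ` on the boundary, relative to `∂O`, of the shadowed region. -/
def castBoundary (u : E3) : Set E3 := relBoundary (frontier O) (T.shadow ρ u) ∩ T.regularPart

/-- `χ[u]`: the points that cast the shadow boundary, that is, the shadow retractions of the
points of `C[u]`. -/
def shadowEdges (u : E3) : Set E3 :=
  {y | ∃ x ∈ T.castBoundary ρ u, IsShadowRetraction O u x y}

/-- `χ⋆`: the supremum over all directions `u` of the length (one-dimensional Hausdorff measure)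
of `χ[u]`. -/
noncomputable def maxShadowEdgeLength : ℝ≥0∞ :=
  ⨆ u ∈ Metric.sphere (0 : E3) 1, Measure.hausdorffMeasure 1 (T.shadowEdges ρ u)

end Triangulation

/-!
At points where `u` and `u'` see the same visibility, the direct reflectance changes by at most
`ρ ‖u - u'‖`, since `u ↦ ⟨n, u⟩₊` is 1-Lipschitz. Also where one of the cosines `⟨n, u⟩`, `⟨n, u'⟩`
is not positive, the other positive part is at most `‖u - u'‖`. For a convex object there is no
other case (`not_occluded_of_convex`). What remains is the part of each face which faces both
directions and is occluded in one of them only. On it the squared difference is at most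
`2 ‖u - u'‖² + 2 m`, up to the factor `ρ²`, where `m` is the minimum of the two cosines
(`sq_direct_sub_direct_le`), and the point is to bound the `m`-weighted area of these parts.

Turn the direction along the chord, `w = u + τ (u' - u)` with `τ ∈ [0, 1]`; shadow-casting points
depend on directions only up to positive factors, and `m ≤ ⟨n, w⟩` for all `τ`. At the first time
at which a point `x` of the region gets occluded, the plane through `x` spanned by `u` and `u'`
shows that `x` is a limit of visible points, so that `x` is on the shadow boundary
(`exists_first_occlusion`). The first point `y = x + r w` of the boundary on the ray belongs to
`χ[w]`, and it lies on an edge of the triangulation, because a ray which hits the interior of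
a face is stable (`shadowEdges_subset`); as there are finitely many edges, `χ⋆` is finite.
Therefore the region is covered by the images of the maps which send an arc length parameter `s`
on an edge and a time `τ` to the projection `y - r w` of `y` along `w` to the plane of the face.
The Jacobian of this map, times `⟨n, w⟩`, is `r` times the determinant of the direction of the
edge, `u' - u` and `w`, hence of the order of `diam O ‖u - u'‖`, since `r ‖w‖ = ‖y - x‖`
(`volume_shadowMap_image_le`; the factor `6` comes from estimating the determinant term by term).
For fixed `τ`, a point `y` casts its shadow on one point only, so that the lengths of the sets of
parameters `s`, summed over all faces and edges, are at most the length of `χ[w]`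
(`sum_volume_castSet_le`). By Fubini the weighted area is at most `6 diam O ‖u - u'‖ χ⋆`, which
leads to the constant `24 ≤ 32 √2`.
-/

/-! ### Geometry of the faces -/

lemma tendsto_add_smul_nhdsGT (x z : E3) :
    Filter.Tendsto (fun t : ℝ => x + t • z) (nhdsWithin 0 (Set.Ioi 0)) (nhds x) := by
  have : Continuous fun t : ℝ => x + t • z := by fun_prop
  simpa using this.continuousAt.tendsto.mono_left (nhdsWithin_le_nhds (a := (0 : ℝ)))

lemma min_inner_le_inner_add_smul (n u u' : E3) {τ : ℝ} (hτ : τ ∈ Set.Icc (0 : ℝ) 1) :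
    min ⟪n, u⟫ ⟪n, u'⟫ ≤ ⟪n, u + τ • (u' - u)⟫ := by
  have e : u + τ • (u' - u) = (1 - τ) • u + τ • u' := by module
  rw [e, inner_add_right, inner_smul_right, inner_smul_right]
  nlinarith [hτ.1, hτ.2, min_le_left ⟪n, u⟫ ⟪n, u'⟫, min_le_right ⟪n, u⟫ ⟪n, u'⟫]

namespace Triangulation

variable {O : Set E3} (T : Triangulation O)

lemma linearIndependent_sub_vert (i : Fin T.N) :
    LinearIndependent ℝ ![T.vert i 1 - T.vert i 0, T.vert i 2 - T.vert i 0] := by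
  have h := (affineIndependent_iff_linearIndependent_vsub ℝ (T.vert i) 0).1
    (T.affineIndependent_vert i)
  have h2 := h.comp (fun k : Fin 2 => (⟨k.succ, Fin.succ_ne_zero k⟩ : {x : Fin 3 // x ≠ 0}))
    (fun a b hab => by simpa using hab)
  have h3 : ![T.vert i 1 - T.vert i 0, T.vert i 2 - T.vert i 0]
      = (fun k : {x : Fin 3 // x ≠ 0} => T.vert i k -ᵥ T.vert i 0) ∘
        fun k : Fin 2 => ⟨k.succ, Fin.succ_ne_zero k⟩ := by
    funext k
    fin_cases k <;> rfl
  rw [h3]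
  exact h2

lemma span_sub_vert (i : Fin T.N) :
    Submodule.span ℝ (Set.range ![T.vert i 1 - T.vert i 0, T.vert i 2 - T.vert i 0])
      = (ℝ ∙ T.normal i)ᗮ := by
  have hn : T.normal i ≠ 0 := fun h => by simpa [h] using T.norm_normal i
  have : Fact (Module.finrank ℝ E3 = 2 + 1) := ⟨by simp⟩
  apply Submodule.eq_of_le_of_finrank_eq
  · rw [Submodule.span_le]
    rintro _ ⟨k, rfl⟩
    rw [SetLike.mem_coe, Submodule.mem_orthogonal_singleton_iff_inner_right]
    fin_cases k <;> exact T.normal_orthogonal i _ _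
  · rw [finrank_span_eq_card (T.linearIndependent_sub_vert i),
      Submodule.finrank_orthogonal_span_singleton (n := 2) hn]
    simp

lemma exists_eq_of_inner_normal_eq_zero (i : Fin T.N) {z : E3} (hz : ⟪T.normal i, z⟫ = 0) :
    ∃ a b : ℝ, z = a • (T.vert i 1 - T.vert i 0) + b • (T.vert i 2 - T.vert i 0) := by
  have h : z ∈ Submodule.span ℝ
      (Set.range ![T.vert i 1 - T.vert i 0, T.vert i 2 - T.vert i 0]) := by
    rw [span_sub_vert, Submodule.mem_orthogonal_singleton_iff_inner_right]
    exact hz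
  rw [Submodule.mem_span_range_iff_exists_fun] at h
  obtain ⟨c, rfl⟩ := h
  exact ⟨c 0, c 1, by simp [Fin.sum_univ_two]⟩

/-- The affine span of a face is the plane through a vertex orthogonal to the normal. -/
lemma mem_affineSpan_face_iff (i : Fin T.N) {x : E3} :
    x ∈ affineSpan ℝ (T.face i) ↔ ⟪T.normal i, x - T.vert i 0⟫ = 0 := by
  rw [face, affineSpan_convexHull]
  constructor
  · intro h
    have h0 : T.vert i 0 ∈ affineSpan ℝ (Set.range (T.vert i)) :=
      subset_affineSpan ℝ _ ⟨0, rfl⟩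
    have h1 : x -ᵥ T.vert i 0 ∈ vectorSpan ℝ (Set.range (T.vert i)) := by
      rw [← direction_affineSpan]
      exact AffineSubspace.vsub_mem_direction h h0
    rw [vectorSpan_range_eq_span_range_vsub_right ℝ _ 0] at h1
    have h2 : Submodule.span ℝ (Set.range fun k => T.vert i k -ᵥ T.vert i 0)
        ≤ (ℝ ∙ T.normal i)ᗮ := by
      rw [Submodule.span_le]
      rintro _ ⟨k, rfl⟩
      rw [SetLike.mem_coe, Submodule.mem_orthogonal_singleton_iff_inner_right]
      exact T.normal_orthogonal i _ _
    exact Submodule.mem_orthogonal_singleton_iff_inner_right.1 (h2 h1)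
  · intro h
    obtain ⟨a, b, hab⟩ := T.exists_eq_of_inner_normal_eq_zero i h
    have hmem : ∀ k, T.vert i k ∈ affineSpan ℝ (Set.range (T.vert i)) :=
      fun k => subset_affineSpan ℝ _ ⟨k, rfl⟩
    have h1 : x - T.vert i 0 ∈ (affineSpan ℝ (Set.range (T.vert i))).direction := by
      rw [hab]
      exact Submodule.add_mem _
        (Submodule.smul_mem _ _ (AffineSubspace.vsub_mem_direction (hmem 1) (hmem 0)))
        (Submodule.smul_mem _ _ (AffineSubspace.vsub_mem_direction (hmem 2) (hmem 0)))
    have := AffineSubspace.vadd_mem_of_mem_direction h1 (hmem 0)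
    simpa using this

/-- The relative interior of a face is the trace of an open set on the plane of the face. -/
lemma exists_isOpen_relInt_eq (i : Fin T.N) :
    ∃ W : Set E3, IsOpen W ∧ T.relInt i = {x | ⟪T.normal i, x - T.vert i 0⟫ = 0} ∩ W := by
  obtain ⟨W, hW, hWeq⟩ := isOpen_induced_iff.1
    (isOpen_interior (s := ((↑) ⁻¹' T.face i : Set (affineSpan ℝ (T.face i)))))
  refine ⟨W, hW, ?_⟩
  ext x
  rw [relInt, mem_intrinsicInterior, Set.mem_inter_iff, Set.mem_ofPred_eq,
    ← mem_affineSpan_face_iff]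
  constructor
  · rintro ⟨y, hy, rfl⟩
    rw [← hWeq] at hy
    exact ⟨y.2, hy⟩
  · rintro ⟨h1, h2⟩
    exact ⟨⟨x, h1⟩, by rw [← hWeq]; exact h2, rfl⟩

lemma relInt_subset_face (i : Fin T.N) : T.relInt i ⊆ T.face i := intrinsicInterior_subset

lemma face_subset_frontier (i : Fin T.N) : T.face i ⊆ frontier O := by
  rw [T.frontier_eq]
  exact Set.subset_iUnion (fun i => convexHull ℝ (Set.range (T.vert i))) i

lemma relInt_subset_frontier (i : Fin T.N) : T.relInt i ⊆ frontier O :=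
  (T.relInt_subset_face i).trans (T.face_subset_frontier i)

lemma inner_normal_sub_of_mem_relInt {i : Fin T.N} {x : E3} (hx : x ∈ T.relInt i) :
    ⟪T.normal i, x - T.vert i 0⟫ = 0 := by
  obtain ⟨W, -, h⟩ := T.exists_isOpen_relInt_eq i
  rw [h] at hx
  exact hx.1

lemma exists_ball_plane_subset_relInt {i : Fin T.N} {x : E3} (hx : x ∈ T.relInt i) :
    ∃ ε > 0, ∀ y ∈ Metric.ball x ε, ⟪T.normal i, y - x⟫ = 0 → y ∈ T.relInt i := by
  obtain ⟨W, hW, h⟩ := T.exists_isOpen_relInt_eq i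
  have hx' := hx
  rw [h] at hx'
  obtain ⟨ε, hε, hb⟩ := Metric.isOpen_iff.1 hW x hx'.2
  refine ⟨ε, hε, fun y hy hyx => ?_⟩
  rw [h]
  refine ⟨?_, hb hy⟩
  have : y - T.vert i 0 = (y - x) + (x - T.vert i 0) := by abel
  rw [Set.mem_ofPred_eq, this, inner_add_right, hyx, hx'.1, add_zero]

lemma measurableSet_relInt (i : Fin T.N) : MeasurableSet (T.relInt i) := by
  obtain ⟨W, hW, h⟩ := T.exists_isOpen_relInt_eq i
  rw [h]
  refine MeasurableSet.inter (IsClosed.measurableSet ?_) hW.measurableSet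
  exact isClosed_eq (by fun_prop) continuous_const

/-- A point of a face with positive barycentric coordinates is in the relative interior. -/
lemma mem_relInt_of_pos (i : Fin T.N) {a b : ℝ} (ha : 0 < a) (hb : 0 < b) (hab : a + b < 1) :
    T.vert i 0 + (a • (T.vert i 1 - T.vert i 0) + b • (T.vert i 2 - T.vert i 0))
      ∈ T.relInt i := by
  set e₁ := T.vert i 1 - T.vert i 0 with he₁
  set e₂ := T.vert i 2 - T.vert i 0 with he₂
  let L : ℝ × ℝ →ₗ[ℝ] E3 :=
    (LinearMap.fst ℝ ℝ ℝ).smulRight e₁ + (LinearMap.snd ℝ ℝ ℝ).smulRight e₂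
  have hL : ∀ p, L p = p.1 • e₁ + p.2 • e₂ := fun p => rfl
  have hinj : LinearMap.ker L = ⊥ := by
    rw [LinearMap.ker_eq_bot']
    rintro ⟨p, q⟩ hpq
    have := LinearIndependent.pair_iff.1 (T.linearIndependent_sub_vert i) p q hpq
    ext <;> simp [this]
  have hemb := LinearMap.isClosedEmbedding_of_injective hinj
  have hU : IsOpen {p : ℝ × ℝ | 0 < p.1 ∧ 0 < p.2 ∧ p.1 + p.2 < 1} :=
    (isOpen_lt continuous_const continuous_fst).inter
      ((isOpen_lt continuous_const continuous_snd).inter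
        (isOpen_lt (continuous_fst.add continuous_snd) continuous_const))
  obtain ⟨V, hV, hVU⟩ := hemb.isInducing.isOpen_iff.1 hU
  have hface : ∀ p ∈ {p : ℝ × ℝ | 0 < p.1 ∧ 0 < p.2 ∧ p.1 + p.2 < 1},
      T.vert i 0 + L p ∈ T.face i := by
    rintro p ⟨h1, h2, h3⟩
    have hv : ∀ k, T.vert i k ∈ T.face i := fun k => subset_convexHull ℝ _ ⟨k, rfl⟩
    have hc : Convex ℝ (T.face i) := convex_convexHull ℝ _
    have := hc.sum_mem (t := Finset.univ) (w := ![1 - p.1 - p.2, p.1, p.2]) (z := T.vert i)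
      (fun k _ => by fin_cases k <;> simp <;> linarith)
      (by simp [Fin.sum_univ_three]; ring) (fun k _ => hv k)
    convert this using 1
    simp only [hL, Fin.sum_univ_three, he₁, he₂]
    simp
    module
  rw [relInt, mem_intrinsicInterior]
  have hmem : T.vert i 0 + (a • e₁ + b • e₂) ∈ affineSpan ℝ (T.face i) :=
    subset_affineSpan ℝ _ (hface (a, b) ⟨ha, hb, hab⟩)
  refine ⟨⟨_, hmem⟩, ?_, rfl⟩
  rw [mem_interior]
  refine ⟨(fun y : affineSpan ℝ (T.face i) => (y : E3) - T.vert i 0) ⁻¹' V, ?_,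
    hV.preimage (by fun_prop), ?_⟩
  · rintro ⟨y, hy⟩ hyV
    obtain ⟨p, q, hpq⟩ := T.exists_eq_of_inner_normal_eq_zero i
      ((T.mem_affineSpan_face_iff i).1 hy)
    have hyV' : L (p, q) ∈ V := by rw [hL, ← hpq]; exact hyV
    have hm : (p, q) ∈ L ⁻¹' V := hyV'
    rw [hVU] at hm
    have h := hface _ hm
    rw [hL, ← hpq, add_sub_cancel] at h
    exact h
  · have hm : (a, b) ∈ L ⁻¹' V := by rw [hVU]; exact ⟨ha, hb, hab⟩
    simpa [hL] using hm

/-- The edges of the triangulation, indexed by a face and the initial vertex of an edge in the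
cyclic order of the vertices of this face. -/
def edge (j : Fin T.N × Fin 3) : Set E3 := segment ℝ (T.vert j.1 j.2) (T.vert j.1 (j.2 + 1))

lemma face_subset (i : Fin T.N) : T.face i ⊆ T.relInt i ∪ ⋃ j, T.edge j := by
  have key : T.face i ⊆ {x | ∃ a b : ℝ, 0 ≤ a ∧ 0 ≤ b ∧ a + b ≤ 1 ∧
      x = T.vert i 0 + (a • (T.vert i 1 - T.vert i 0) + b • (T.vert i 2 - T.vert i 0))} := by
    refine convexHull_min ?_ ?_
    · rintro _ ⟨k, rfl⟩
      fin_cases k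
      · exact ⟨0, 0, by simp⟩
      · exact ⟨1, 0, by simp⟩
      · exact ⟨0, 1, by simp⟩
    · rintro _ ⟨a, b, ha, hb, hab, rfl⟩ _ ⟨a', b', ha', hb', hab', rfl⟩ s t hs ht hst
      refine ⟨s * a + t * a', s * b + t * b', by positivity, by positivity, by nlinarith, ?_⟩
      obtain rfl : t = 1 - s := by linarith
      module
  intro x hx
  obtain ⟨a, b, ha, hb, hab, rfl⟩ := key hx
  by_cases hpos : 0 < a ∧ 0 < b ∧ a + b < 1
  · exact Or.inl (T.mem_relInt_of_pos i hpos.1 hpos.2.1 hpos.2.2)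
  right
  rw [Set.mem_iUnion]
  rcases ha.eq_or_lt with rfl | ha
  · refine ⟨(i, 2), b, 1 - b, hb, by linarith, by ring, ?_⟩
    change b • T.vert i 2 + (1 - b) • T.vert i 0 = _
    module
  rcases hb.eq_or_lt with rfl | hb
  · refine ⟨(i, 0), 1 - a, a, by linarith, ha.le, by ring, ?_⟩
    change (1 - a) • T.vert i 0 + a • T.vert i 1 = _
    module
  · obtain rfl : b = 1 - a := by
      by_contra hne
      exact hpos ⟨ha, hb, lt_of_le_of_ne hab fun h => hne (by linarith)⟩
    refine ⟨(i, 1), a, 1 - a, ha.le, hb.le, by ring, ?_⟩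
    change a • T.vert i 1 + (1 - a) • T.vert i 2 = _
    module

lemma frontier_subset : frontier O ⊆ T.regularPart ∪ ⋃ j, T.edge j := by
  rw [T.frontier_eq]
  refine Set.iUnion_subset fun i x hx => ?_
  rcases T.face_subset i hx with h | h
  · exact Or.inl (Set.mem_iUnion.2 ⟨i, h⟩)
  · exact Or.inr h

/-- The outward normal at a point is determined by the shape of `O` near this point. -/
lemma normal_eq_of_mem_relInt {i j : Fin T.N} {x : E3} (hi : x ∈ T.relInt i)
    (hj : x ∈ T.relInt j) : T.normal i = T.normal j := by
  obtain ⟨ε, hε, h1⟩ := T.outward i x hi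
  obtain ⟨ε', hε', h2⟩ := T.outward j x hj
  have hni := T.norm_normal i
  have hnj := T.norm_normal j
  set z := T.normal j - T.normal i with hz
  have hlim := tendsto_add_smul_nhdsGT x z
  obtain ⟨t, ⟨ht1, ht2⟩, ht0⟩ :=
    ((hlim.eventually ((Metric.ball_mem_nhds x hε))).and
      (hlim.eventually (Metric.ball_mem_nhds x hε'))|>.and self_mem_nhdsWithin).exists
  have ht0 : 0 < t := ht0
  have e1 := h1 _ ht1
  have e2 := h2 _ ht2
  simp only [add_sub_cancel_left, inner_smul_right] at e1 e2
  have hc : ⟪T.normal i, T.normal j⟫ ≤ 1 := by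
    simpa [hni, hnj] using real_inner_le_norm (T.normal i) (T.normal j)
  have a1 : ⟪T.normal i, z⟫ = ⟪T.normal i, T.normal j⟫ - 1 := by
    rw [hz, inner_sub_right, real_inner_self_eq_norm_sq, hni]; norm_num
  have a2 : ⟪T.normal j, z⟫ = 1 - ⟪T.normal i, T.normal j⟫ := by
    rw [hz, inner_sub_right, real_inner_self_eq_norm_sq, hnj, real_inner_comm]; norm_num
  have h3 := (e2.1 (e1.2 (by rw [a1]; nlinarith)))
  rw [a2] at h3
  have h4 : ⟪T.normal i, T.normal j⟫ = 1 := by nlinarith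
  exact (inner_eq_one_iff_of_norm_eq_one hni hnj).1 h4

/-- If the relative interiors met, then the faces would have a common disc, but their intersection
is contained in a segment. -/
lemma relInt_disjoint {i j : Fin T.N} (hij : i ≠ j) : Disjoint (T.relInt i) (T.relInt j) := by
  rw [Set.disjoint_left]
  intro x hi hj
  have hn := T.normal_eq_of_mem_relInt hi hj
  obtain ⟨ε, hε, h1⟩ := T.exists_ball_plane_subset_relInt hi
  obtain ⟨ε', hε', h2⟩ := T.exists_ball_plane_subset_relInt hj
  obtain ⟨p, q, hpq⟩ : ∃ p q, T.face i ∩ T.face j ⊆ segment ℝ p q := by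
    rcases T.inter_mem i j hij with (h | ⟨l, k, h⟩) | ⟨l, k, k', -, h⟩
    · exact ⟨0, 0, by rw [face, face, h]; exact Set.empty_subset _⟩
    · exact ⟨T.vert l k, T.vert l k, by rw [face, face, h, segment_same]⟩
    · exact ⟨T.vert l k, T.vert l k', by rw [face, face, h, convexHull_pair]⟩
  have hev : ∀ z : E3, ⟪T.normal i, z⟫ = 0 →
      ∀ᶠ η in nhdsWithin (0 : ℝ) (Set.Ioi 0), x + η • z ∈ segment ℝ p q := by
    intro z hz
    have hlim := tendsto_add_smul_nhdsGT x z
    filter_upwards [hlim.eventually ((Metric.ball_mem_nhds x hε)),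
      hlim.eventually (Metric.ball_mem_nhds x hε')] with t ht1 ht2
    refine hpq ⟨T.relInt_subset_face i (h1 _ ht1 ?_), T.relInt_subset_face j (h2 _ ht2 ?_)⟩
    · simp [inner_smul_right, hz]
    · simp [inner_smul_right, ← hn, hz]
  obtain ⟨η, ⟨⟨s1, s2⟩, hη⟩⟩ := (((hev _ (T.normal_orthogonal i 1 0)).and
    (hev _ (T.normal_orthogonal i 2 0))).and self_mem_nhdsWithin).exists
  have hη : 0 < η := hη
  have s0 := hpq ⟨T.relInt_subset_face i hi, T.relInt_subset_face j hj⟩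
  rw [segment_eq_image'] at s0 s1 s2
  obtain ⟨t0, -, r0⟩ := s0
  obtain ⟨t1, -, r1⟩ := s1
  obtain ⟨t2, -, r2⟩ := s2
  simp only at r0 r1 r2
  have k1 : η • (T.vert i 1 - T.vert i 0) = (t1 - t0) • (q - p) := by
    rw [sub_smul, eq_sub_iff_add_eq'.2 r0, eq_sub_iff_add_eq'.2 r1]; abel
  have k2 : η • (T.vert i 2 - T.vert i 0) = (t2 - t0) • (q - p) := by
    rw [sub_smul, eq_sub_iff_add_eq'.2 r0, eq_sub_iff_add_eq'.2 r2]; abel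
  have hli := LinearIndependent.pair_iff.1 (T.linearIndependent_sub_vert i)
  have k3 := hli ((t2 - t0) * η) (-((t1 - t0) * η)) (by
    rw [neg_smul, mul_smul, mul_smul, k1, k2, smul_comm, add_neg_cancel])
  have k4 : t1 - t0 = 0 := by
    have := k3.2
    rcases mul_eq_zero.1 (neg_eq_zero.1 this) with h | h
    · exact h
    · exact absurd h hη.ne'
  rw [k4, zero_smul] at k1
  have := hli η 0 (by rw [k1]; simp)
  exact hη.ne' this.1

lemma normalAt_eq {i : Fin T.N} {x : E3} (hx : x ∈ T.relInt i) : T.normalAt x = T.normal i := by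
  have h : ∃ i, x ∈ T.relInt i := ⟨i, hx⟩
  rw [normalAt, dif_pos h]
  exact T.normal_eq_of_mem_relInt h.choose_spec hx

end Triangulation

/-! ### Occlusion and the shadow boundary -/

/-- The point `x` is occluded in direction `w`: the open ray from `x` in direction `w` meets
`O`. -/
def Occluded (O : Set E3) (x w : E3) : Prop := ∃ t : ℝ, 0 < t ∧ x + t • w ∈ O

open Classical in
lemma visibility_eq {O : Set E3} {x w : E3} (hx : x ∈ O) (hw : w ≠ 0) :
    visibility O x w = if Occluded O x w then 0 else 1 := by
  have : ({y | ∃ t : ℝ, 0 ≤ t ∧ y = x + t • w} ∩ O = {x}) ↔ ¬ Occluded O x w := by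
    constructor
    · rintro h ⟨t, ht, hO⟩
      have h1 : x + t • w ∈ ({x} : Set E3) := by
        rw [← h]
        exact ⟨⟨t, ht.le, rfl⟩, hO⟩
      rw [Set.mem_singleton_iff, add_eq_left, smul_eq_zero] at h1
      exact h1.elim ht.ne' hw
    · intro h
      apply Set.Subset.antisymm
      · rintro _ ⟨⟨t, ht, rfl⟩, hO⟩
        rcases ht.eq_or_lt with rfl | ht
        · simp
        · exact absurd ⟨t, ht, hO⟩ h
      · rintro _ rfl
        exact ⟨⟨0, le_rfl, by simp⟩, hx⟩
  rw [visibility]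
  by_cases h : Occluded O x w <;> simp [this, h]

lemma mem_relBoundary_iff {X S : Set E3} {x : E3} :
    x ∈ relBoundary X S ↔ x ∈ X ∧ x ∈ closure (X ∩ S) ∧ x ∈ closure (X \ S) := by
  rw [relBoundary]
  constructor
  · rintro ⟨y, hy, rfl⟩
    rw [frontier_eq_closure_inter_closure] at hy
    refine ⟨y.2, ?_, ?_⟩
    · simpa [closure_subtype, Subtype.image_preimage_coe] using hy.1
    · have := hy.2
      rw [closure_subtype, ← Set.preimage_compl, Subtype.image_preimage_coe] at this
      exact this
  · rintro ⟨h1, h2, h3⟩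
    refine ⟨⟨x, h1⟩, ?_, rfl⟩
    rw [frontier_eq_closure_inter_closure]
    constructor
    · rw [closure_subtype, Subtype.image_preimage_coe]
      exact h2
    · rw [closure_subtype, ← Set.preimage_compl, Subtype.image_preimage_coe]
      exact h3

namespace Triangulation

variable {O : Set E3} (T : Triangulation O)

open Classical in
lemma direct_eq (hO : IsClosed O) (ρ : E3 → ℝ) {i : Fin T.N} {x w : E3} (hx : x ∈ T.relInt i) :
    T.direct ρ w x = ρ x * (max ⟪T.normal i, w⟫ 0 * if Occluded O x w then 0 else 1) := by
  have hreg : x ∈ T.regularPart := Set.mem_iUnion.2 ⟨i, hx⟩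
  rw [direct, if_pos hreg, T.normalAt_eq hx]
  rcases eq_or_ne w 0 with rfl | hw
  · simp
  · rw [visibility_eq (hO.frontier_subset (T.relInt_subset_frontier i hx)) hw, mul_assoc]

lemma mem_shadow_iff (hO : IsClosed O) {ρ : E3 → ℝ} (hρ : ∀ x ∈ frontier O, 0 < ρ x)
    {i : Fin T.N} {x w : E3} (hx : x ∈ T.relInt i) :
    x ∈ T.shadow ρ w ↔ ⟪T.normal i, w⟫ ≤ 0 ∨ Occluded O x w := by
  have hxf := T.relInt_subset_frontier i hx
  have := (hρ x hxf).ne'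
  rw [shadow, Set.mem_ofPred_eq, T.direct_eq hO ρ hx]
  simp only [hxf, true_and, mul_eq_zero, this, false_or, max_eq_right_iff]
  by_cases h : Occluded O x w <;> simp [h]

/-- Near a point of the relative interior of a face, this face is the whole boundary, as `O` is
a half-space there. -/
lemma exists_ball_frontier_subset_relInt {i : Fin T.N} {x : E3} (hx : x ∈ T.relInt i) :
    ∃ ε > 0, ∀ y ∈ Metric.ball x ε, y ∈ frontier O → y ∈ T.relInt i := by
  obtain ⟨ε, hε, h⟩ := T.outward i x hx
  obtain ⟨ε', hε', h'⟩ := T.exists_ball_plane_subset_relInt hx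
  refine ⟨min ε ε', lt_min hε hε', fun y hy hyO => ?_⟩
  have hy1 : y ∈ Metric.ball x ε := Metric.ball_subset_ball (min_le_left _ _) hy
  refine h' y (Metric.ball_subset_ball (min_le_right _ _) hy) ?_
  have hc : Continuous fun z : E3 => ⟪T.normal i, z - x⟫ := by fun_prop
  rcases lt_trichotomy ⟪T.normal i, y - x⟫ 0 with hlt | heq | hgt
  · exfalso
    refine hyO.2 (mem_interior_iff_mem_nhds.2 ?_)
    filter_upwards [Metric.isOpen_ball.mem_nhds hy1, (isOpen_lt hc continuous_const).mem_nhds hlt]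
      with z hz1 hz2
    exact (h z hz1).2 (le_of_lt hz2)
  · exact heq
  · exfalso
    obtain ⟨z, ⟨hz1, hz2⟩, hz3⟩ := mem_closure_iff_nhds.1 hyO.1 _ (Filter.inter_mem
      (Metric.isOpen_ball.mem_nhds hy1) ((isOpen_lt continuous_const hc).mem_nhds hgt))
    exact absurd ((h z hz1).1 hz3) (not_le.2 hz2)

/-- Rays that leave a face on its outer side stay out of `O` for a while. -/
lemma exists_forall_notMem {i : Fin T.N} {x : E3} (hx : x ∈ T.relInt i) :
    ∃ ε > 0, ∀ z : E3, ‖z‖ < ε → 0 < ⟪T.normal i, z⟫ → x + z ∉ O := by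
  obtain ⟨ε, hε, h⟩ := T.outward i x hx
  refine ⟨ε, hε, fun z hz hn hO => ?_⟩
  have := (h (x + z) (by simpa using hz)).1 hO
  rw [add_sub_cancel_left] at this
  linarith

lemma mem_castBoundary (hO : IsClosed O) {ρ : E3 → ℝ} (hρ : ∀ x ∈ frontier O, 0 < ρ x)
    {i : Fin T.N} {x w : E3} (hx : x ∈ T.relInt i) (hw : 0 < ⟪T.normal i, w⟫)
    (hocc : Occluded O x w) (hlim : x ∈ closure {z | z ∈ T.relInt i ∧ ¬ Occluded O z w}) :
    x ∈ T.castBoundary ρ w := by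
  have hxf := T.relInt_subset_frontier i hx
  refine ⟨mem_relBoundary_iff.2 ⟨hxf, subset_closure ⟨hxf, ?_⟩, closure_mono ?_ hlim⟩,
    Set.mem_iUnion.2 ⟨i, hx⟩⟩
  · exact (T.mem_shadow_iff hO hρ hx).2 (Or.inr hocc)
  · rintro z ⟨hz, hzo⟩
    refine ⟨T.relInt_subset_frontier i hz, fun h => ?_⟩
    exact ((T.mem_shadow_iff hO hρ hz).1 h).elim (not_le.2 hw) hzo

/-- A point of the shadow boundary is on a face whose outer side is turned towards `w`: the faces
turned away are all in the shadow. In particular it is a limit of visible points. -/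
lemma exists_of_mem_castBoundary (hO : IsClosed O) {ρ : E3 → ℝ}
    (hρ : ∀ x ∈ frontier O, 0 < ρ x) {x w : E3} (hx : x ∈ T.castBoundary ρ w) :
    ∃ i, x ∈ T.relInt i ∧ 0 < ⟪T.normal i, w⟫ ∧
      x ∈ closure {z | z ∈ T.relInt i ∧ ¬ Occluded O z w} := by
  obtain ⟨hb, hreg⟩ := hx
  obtain ⟨i, hi⟩ := Set.mem_iUnion.1 hreg
  obtain ⟨-, -, h2⟩ := mem_relBoundary_iff.1 hb
  obtain ⟨ε, hε, hball⟩ := T.exists_ball_frontier_subset_relInt hi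
  have key : x ∈ closure {z | z ∈ T.relInt i ∧ (0 < ⟪T.normal i, w⟫ ∧ ¬ Occluded O z w)} := by
    rw [mem_closure_iff_nhds]
    intro U hU
    obtain ⟨z, ⟨hzU, hzb⟩, hzf, hzs⟩ := mem_closure_iff_nhds.1 h2 _
      (Filter.inter_mem hU (Metric.ball_mem_nhds x hε))
    have hzi := hball z hzb hzf
    rw [T.mem_shadow_iff hO hρ hzi, not_or, not_le] at hzs
    exact ⟨z, hzU, hzi, hzs⟩
  refine ⟨i, hi, ?_, closure_mono ?_ key⟩
  swap
  · exact fun z hz => ⟨hz.1, hz.2.2⟩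
  obtain ⟨z, hz⟩ := closure_nonempty_iff.1 ⟨x, key⟩
  exact hz.2.1

/-- The points that cast the shadow boundary lie on the edges of the triangulation: a ray that
leaves `Φ` and first hits the boundary inside a face, crosses this face, and so do all nearby
rays. -/
lemma shadowEdges_subset (hO : IsClosed O) {ρ : E3 → ℝ} (hρ : ∀ x ∈ frontier O, 0 < ρ x)
    (w : E3) : T.shadowEdges ρ w ⊆ ⋃ j, T.edge j := by
  rintro y ⟨x, hx, hne, hy⟩
  obtain ⟨i, hi, hw, hlim⟩ := T.exists_of_mem_castBoundary hO hρ hx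
  have hw0 : w ≠ 0 := by rintro rfl; simp at hw
  have hwn : 0 < ‖w‖ := norm_pos_iff.2 hw0
  obtain ⟨ε, hε, hout⟩ := T.exists_forall_notMem hi
  set A := {t : ℝ | 0 < t ∧ x + t • w ∈ frontier O} with hA
  have hAlb : ∀ t ∈ A, ε / ‖w‖ ≤ t := by
    rintro t ⟨ht, htO⟩
    by_contra! hlt
    rw [lt_div_iff₀ hwn] at hlt
    refine hout (t • w) ?_ ?_ (hO.frontier_subset htO)
    · rwa [norm_smul, Real.norm_of_nonneg ht.le]
    · rw [inner_smul_right]; positivity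
  have hAeq : A = {t : ℝ | ε / ‖w‖ ≤ t} ∩ (fun t : ℝ => x + t • w) ⁻¹' frontier O := by
    ext t
    exact ⟨fun h => ⟨hAlb t h, h.2⟩, fun h => ⟨lt_of_lt_of_le (by positivity) h.1, h.2⟩⟩
  have hAclosed : IsClosed A := by
    rw [hAeq]
    exact (isClosed_le continuous_const continuous_id).inter
      (isClosed_frontier.preimage (by fun_prop))
  have hbdd : BddBelow A := ⟨_, hAlb⟩
  have hr := hAclosed.csInf_mem hne hbdd
  set r := sInf A with hrdef
  have hyf : y ∈ frontier O := hy ▸ hr.2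
  refine (T.frontier_subset hyf).resolve_left fun hreg => ?_
  obtain ⟨j, hj⟩ := Set.mem_iUnion.1 hreg
  by_cases hnj : ⟪T.normal j, w⟫ = 0
  · -- the ray runs inside the face through `y`, hence meets the boundary before `y`
    obtain ⟨ε', hε', hb⟩ := T.exists_ball_plane_subset_relInt hj
    obtain ⟨η, ⟨h1, h2⟩, h3⟩ := (((tendsto_add_smul_nhdsGT y (-w)).eventually
      (Metric.ball_mem_nhds y hε')).and (Ioo_mem_nhdsGT hr.1)|>.and self_mem_nhdsWithin).exists
    have h3 : 0 < η := h3
    have hmem := T.relInt_subset_frontier j (hb _ h1 (by simp [inner_smul_right, hnj]))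
    have : r - η ∈ A := by
      refine ⟨by linarith [h2.2], ?_⟩
      convert hmem using 1
      rw [hy]
      module
    linarith [csInf_le hbdd this]
  · -- the ray crosses the face through `y`, and so do the rays from points near `x`
    obtain ⟨ε', hε', hb⟩ := T.outward j y hj
    obtain ⟨σ, hσ, hσ1⟩ : ∃ σ : ℝ, ⟪T.normal j, σ • w⟫ < 0 ∧ |σ| ≤ 1 := by
      rcases lt_or_gt_of_ne hnj with h | h
      · exact ⟨1, by simpa using h, by simp⟩
      · exact ⟨-1, by simpa using h, by simp⟩
    obtain ⟨η, ⟨h1, h2⟩, h3⟩ := (((tendsto_add_smul_nhdsGT y (σ • w)).eventually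
      (Metric.ball_mem_nhds y hε')).and (Ioo_mem_nhdsGT hr.1)|>.and self_mem_nhdsWithin).exists
    have h3 : 0 < η := h3
    have hc : Continuous fun z : E3 => z + (r + η * σ) • w := by fun_prop
    have hxy : x + (r + η * σ) • w = y + η • σ • w := by rw [hy]; module
    have hU : (fun z : E3 => z + (r + η * σ) • w) ⁻¹'
        (Metric.ball y ε' ∩ {z | ⟪T.normal j, z - y⟫ < 0}) ∈ nhds x := by
      refine (IsOpen.preimage hc (Metric.isOpen_ball.inter
        (isOpen_lt (by fun_prop) continuous_const))).mem_nhds ?_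
      rw [Set.mem_preimage, hxy]
      refine ⟨h1, ?_⟩
      rw [Set.mem_ofPred_eq, add_sub_cancel_left, inner_smul_right]
      exact mul_neg_of_pos_of_neg h3 hσ
    obtain ⟨z, ⟨hz1, hz2⟩, -, hz3⟩ := mem_closure_iff_nhds.1 hlim _ hU
    refine hz3 ⟨r + η * σ, ?_, (hb _ hz1).2 (le_of_lt hz2)⟩
    have := (abs_le.1 hσ1).1
    nlinarith [h2.2]

lemma maxShadowEdgeLength_ne_top (hO : IsClosed O) {ρ : E3 → ℝ}
    (hρ : ∀ x ∈ frontier O, 0 < ρ x) : T.maxShadowEdgeLength ρ ≠ ∞ := by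
  have hle : T.maxShadowEdgeLength ρ
      ≤ ∑ j, Measure.hausdorffMeasure 1 (T.edge j) := by
    refine iSup₂_le fun w _ => (measure_mono (T.shadowEdges_subset hO hρ w)).trans ?_
    exact measure_iUnion_fintype_le _ _
  refine ne_top_of_le_ne_top ?_ hle
  refine ENNReal.sum_ne_top.2 fun j _ => ?_
  rw [edge, hausdorffMeasure_segment]
  exact edist_ne_top _ _

lemma direct_smul (ρ : E3 → ℝ) {c : ℝ} (hc : 0 < c) (w x : E3) :
    T.direct ρ (c • w) x = c * T.direct ρ w x := by
  have h1 : {y | ∃ t : ℝ, 0 ≤ t ∧ y = x + t • c • w} = {y | ∃ t : ℝ, 0 ≤ t ∧ y = x + t • w} := by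
    ext y
    constructor
    · rintro ⟨t, ht, rfl⟩
      exact ⟨t * c, by positivity, by rw [mul_smul]⟩
    · rintro ⟨t, ht, rfl⟩
      exact ⟨t / c, by positivity, by rw [smul_smul, div_mul_cancel₀ _ hc.ne']⟩
  rw [direct, direct, visibility, visibility, h1, inner_smul_right,
    ← mul_zero c, ← mul_max_of_nonneg _ _ hc.le]
  split_ifs <;> simp [mul_left_comm]

open scoped Pointwise in
/-- A shadow retraction depends on the direction `w` only up to a positive factor. -/
lemma shadowEdges_smul (ρ : E3 → ℝ) {c : ℝ} (hc : 0 < c) (w : E3) :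
    T.shadowEdges ρ (c • w) = T.shadowEdges ρ w := by
  have h1 : T.castBoundary ρ (c • w) = T.castBoundary ρ w := by
    simp [castBoundary, shadow, T.direct_smul ρ hc, hc.ne']
  have h2 : ∀ x, {t : ℝ | 0 < t ∧ x + t • w ∈ frontier O}
      = c • {t : ℝ | 0 < t ∧ x + t • c • w ∈ frontier O} := by
    intro x
    ext t
    rw [Set.mem_smul_set_iff_inv_smul_mem₀ hc.ne']
    simp [smul_smul, hc, mul_right_comm, hc.ne']
  have h3 : ∀ x y, IsShadowRetraction O (c • w) x y ↔ IsShadowRetraction O w x y := by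
    intro x y
    rw [IsShadowRetraction, IsShadowRetraction, h2 x, Set.smul_set_nonempty,
      Real.sInf_smul_of_nonneg hc.le, smul_smul, smul_eq_mul, mul_comm c]
  simp [shadowEdges, h1, h3]

lemma hausdorffMeasure_shadowEdges_le (ρ : E3 → ℝ) {w : E3} (hw : w ≠ 0) :
    Measure.hausdorffMeasure 1 (T.shadowEdges ρ w) ≤ T.maxShadowEdgeLength ρ := by
  have hwn : 0 < ‖w‖ := norm_pos_iff.2 hw
  rw [← T.shadowEdges_smul ρ (inv_pos.2 hwn) w]
  refine le_iSup₂_of_le (‖w‖⁻¹ • w) ?_ le_rfl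
  simp [norm_smul, hwn.ne']

lemma isShadowRetraction_of_forall_notMem {x w : E3} {r : ℝ} (hr : 0 < r)
    (hmem : x + r • w ∈ frontier O) (hfirst : ∀ t ∈ Set.Ioo 0 r, x + t • w ∉ frontier O) :
    IsShadowRetraction O w x (x + r • w) := by
  have : IsLeast {t : ℝ | 0 < t ∧ x + t • w ∈ frontier O} r := by
    refine ⟨⟨hr, hmem⟩, ?_⟩
    rintro t ⟨ht, htO⟩
    by_contra! hlt
    exact hfirst t ⟨ht, hlt⟩ htO
  exact ⟨this.nonempty, by rw [this.csInf_eq]⟩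

/-- When the direction turns from `u` to `u'` and occludes a point `x` of a face, which is lit
under both directions as far as the normal is concerned, then at the first direction `w` under
which `x` is occluded, `x` is on the shadow boundary: the points of the face that are displaced
from `x` against the turning are not occluded. -/
lemma exists_first_occlusion (hO : IsCompact O) {i : Fin T.N} {x u u' : E3}
    (hx : x ∈ T.relInt i) (hu : 0 < ⟪T.normal i, u⟫) (hu' : 0 < ⟪T.normal i, u'⟫)
    (hocc : ¬ Occluded O x u) (hocc' : Occluded O x u') :
    ∃ τ ∈ Set.Icc (0 : ℝ) 1, ∃ r : ℝ, 0 < r ∧ x + r • (u + τ • (u' - u)) ∈ frontier O ∧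
      (∀ t ∈ Set.Ioo 0 r, x + t • (u + τ • (u' - u)) ∉ frontier O) ∧
      ∀ᶠ δ in nhdsWithin (0 : ℝ) (Set.Ioi 0),
        x + δ • ((⟪T.normal i, u' - u⟫ / ⟪T.normal i, u + τ • (u' - u)⟫) • (u + τ • (u' - u))
          - (u' - u)) ∈ T.relInt i ∧
        ¬ Occluded O (x + δ • ((⟪T.normal i, u' - u⟫ / ⟪T.normal i, u + τ • (u' - u)⟫) •
          (u + τ • (u' - u)) - (u' - u))) (u + τ • (u' - u)) := by
  obtain ⟨ε, hε, hout⟩ := T.exists_forall_notMem hx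
  have hxO : x ∈ O := hO.isClosed.frontier_subset (T.relInt_subset_frontier i hx)
  set n := T.normal i with hn
  set d := u' - u with hd
  have hnorm : ‖n‖ = 1 := T.norm_normal i
  set m := min ⟪n, u⟫ ⟪n, u'⟫ with hm
  have hmpos : 0 < m := lt_min hu hu'
  have hmle : ∀ τ ∈ Set.Icc (0 : ℝ) 1, m ≤ ⟪n, u + τ • d⟫ := fun τ hτ =>
    min_inner_le_inner_add_smul n u u' hτ
  set M := ‖u‖ + ‖d‖ with hM
  have hMle : ∀ τ ∈ Set.Icc (0 : ℝ) 1, ‖u + τ • d‖ ≤ M := by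
    rintro τ ⟨h0, h1⟩
    refine (norm_add_le _ _).trans ?_
    rw [norm_smul, Real.norm_of_nonneg h0]
    nlinarith [norm_nonneg d]
  have hMpos : 0 < M := by
    have : u ≠ 0 := by rintro rfl; simp at hu
    have := norm_pos_iff.2 this
    positivity
  set D := Metric.diam O with hD
  have hrange : ∀ τ ∈ Set.Icc (0 : ℝ) 1, ∀ t > 0, x + t • (u + τ • d) ∈ O →
      t ∈ Set.Icc (ε / M) (D / m) := by
    intro τ hτ t ht htO
    constructor
    · rw [div_le_iff₀ hMpos]
      by_contra! hlt
      refine hout (t • (u + τ • d)) ?_ ?_ htO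
      · rw [norm_smul, Real.norm_of_nonneg ht.le]
        exact (mul_le_mul_of_nonneg_left (hMle τ hτ) ht.le).trans_lt hlt
      · rw [inner_smul_right]
        exact mul_pos ht (hmpos.trans_le (hmle τ hτ))
    · rw [le_div_iff₀ hmpos]
      have h1 := Metric.dist_le_diam_of_mem hO.isBounded htO hxO
      rw [dist_eq_norm, add_sub_cancel_left, norm_smul, Real.norm_of_nonneg ht.le] at h1
      have h2 : ⟪n, u + τ • d⟫ ≤ ‖u + τ • d‖ := by
        simpa [hnorm] using real_inner_le_norm n (u + τ • d)
      nlinarith [hmle τ hτ]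
  -- the first direction under which `x` is occluded
  set K : Set (ℝ × ℝ) := (Set.Icc 0 1 ×ˢ Set.Icc (ε / M) (D / m)) ∩
    (fun p : ℝ × ℝ => x + p.2 • (u + p.1 • d)) ⁻¹' O with hK
  have hKc : IsCompact K := (isCompact_Icc.prod isCompact_Icc).inter_right
    (hO.isClosed.preimage (by fun_prop))
  have hone : u + (1 : ℝ) • d = u' := by rw [hd]; module
  have hKne : K.Nonempty := by
    obtain ⟨t, ht, htO⟩ := hocc'
    rw [← hone] at htO
    exact ⟨(1, t), ⟨⟨by norm_num, by norm_num⟩, hrange 1 (by simp) t ht htO⟩, htO⟩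
  obtain ⟨τ, ⟨⟨p, hpK, hpτ⟩, hτleast⟩⟩ :=
    (hKc.image continuous_fst).exists_isLeast (hKne.image Prod.fst)
  have hτ : τ ∈ Set.Icc (0 : ℝ) 1 := hpτ ▸ hpK.1.1
  have hbefore : ∀ σ, 0 ≤ σ → σ < τ → ¬ Occluded O x (u + σ • d) := by
    rintro σ h0 hστ ⟨t, ht, htO⟩
    have hσ : σ ∈ Set.Icc (0 : ℝ) 1 := ⟨h0, hστ.le.trans hτ.2⟩
    have : σ ∈ Prod.fst '' K := ⟨(σ, t), ⟨⟨hσ, hrange σ hσ t ht htO⟩, htO⟩, rfl⟩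
    exact absurd (hτleast this) (not_le.2 hστ)
  have hτpos : 0 < τ := by
    rcases hτ.1.eq_or_lt with h | h
    · exfalso
      refine hocc ⟨p.2, (div_pos hε hMpos).trans_le hpK.1.2.1, ?_⟩
      have := hpK.2
      simpa [hpτ, ← h] using this
    · exact h
  set w := u + τ • d with hw
  have hnw : 0 < ⟪n, w⟫ := hmpos.trans_le (hmle τ hτ)
  -- the first point of `O` on the ray in this direction
  have hLc : IsCompact (Set.Icc (ε / M) (D / m) ∩ (fun t : ℝ => x + t • w) ⁻¹' O) :=
    isCompact_Icc.inter_right (hO.isClosed.preimage (by fun_prop))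
  obtain ⟨r, ⟨hr, hrO⟩, hrleast⟩ := hLc.exists_isLeast
    ⟨p.2, hpK.1.2, by have := hpK.2; rw [Set.mem_preimage, hpτ] at this; exact this⟩
  have hrpos : 0 < r := (div_pos hε hMpos).trans_le hr.1
  have hfirst : ∀ t ∈ Set.Ioo 0 r, x + t • w ∉ O := fun t ht htO =>
    absurd (hrleast ⟨hrange τ hτ t ht.1 htO, htO⟩) (not_le.2 ht.2)
  refine ⟨τ, hτ, r, hrpos, ?_, fun t ht htO => hfirst t ht (hO.isClosed.frontier_subset htO), ?_⟩
  · rw [hO.isClosed.frontier_eq]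
    refine ⟨hrO, fun hint => ?_⟩
    obtain ⟨η, ⟨h1, h2⟩, h3⟩ := (((tendsto_add_smul_nhdsGT (x + r • w) (-w)).eventually
      (mem_interior_iff_mem_nhds.1 hint)).and (Ioo_mem_nhdsGT hrpos)|>.and
        self_mem_nhdsWithin).exists
    have h3 : 0 < η := h3
    have h1 : x + r • w + η • -w ∈ O := h1
    refine hfirst (r - η) ⟨by linarith [h2.2], by linarith⟩ ?_
    convert h1 using 1
    module
  · set c := ⟪n, d⟫ / ⟪n, w⟫ with hc
    obtain ⟨ε', hε', hplane⟩ := T.exists_ball_plane_subset_relInt hx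
    have hv : ⟪n, c • w - d⟫ = 0 := by
      rw [inner_sub_right, inner_smul_right, hc, div_mul_cancel₀ _ hnw.ne', sub_self]
    have hsmall : ∀ᶠ δ in nhdsWithin (0 : ℝ) (Set.Ioi 0),
        δ * (‖c • w - d‖ + (1 / τ + |c|) * ‖w‖) < ε := by
      have hcont : Continuous fun δ : ℝ => δ * (‖c • w - d‖ + (1 / τ + |c|) * ‖w‖) := by fun_prop
      have := hcont.continuousAt.tendsto.mono_left (nhdsWithin_le_nhds (a := (0 : ℝ))
        (s := Set.Ioi 0))
      rw [zero_mul] at this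
      exact this.eventually (gt_mem_nhds hε)
    filter_upwards [(tendsto_add_smul_nhdsGT x (c • w - d)).eventually
      (Metric.ball_mem_nhds x hε'), hsmall, self_mem_nhdsWithin] with δ h1 h2 h3
    have h3 : 0 < δ := h3
    refine ⟨hplane _ h1 (by rw [add_sub_cancel_left, inner_smul_right, hv, mul_zero]), ?_⟩
    rintro ⟨t, ht, htO⟩
    rcases le_or_gt (δ / τ) (t + δ * c) with hcase | hcase
    · -- this point lies on the ray from `x` in an earlier direction
      have hpos : 0 < t + δ * c := (div_pos h3 hτpos).trans_le hcase
      refine hbefore (τ - δ / (t + δ * c)) ?_ ?_ ⟨t + δ * c, hpos, ?_⟩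
      · rw [div_le_iff₀ hτpos] at hcase
        rw [sub_nonneg, div_le_iff₀ hpos]
        linarith
      · have := div_pos h3 hpos
        linarith
      · convert htO using 1
        have e : (t + δ * c) * (δ / (t + δ * c)) = δ := mul_div_cancel₀ _ hpos.ne'
        have e2 : (t + δ * c) • (u + (τ - δ / (t + δ * c)) • d)
            = (t + δ * c) • w - ((t + δ * c) * (δ / (t + δ * c))) • d := by
          rw [hw]; module
        rw [e2, e]
        module
    · -- this point is close to `x` and on the outer side of the face
      refine hout (δ • (c • w - d) + t • w) ?_ ?_ (by rwa [← add_assoc])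
      · refine lt_of_le_of_lt (norm_add_le _ _) (lt_of_le_of_lt ?_ h2)
        rw [norm_smul, norm_smul, Real.norm_of_nonneg h3.le, Real.norm_of_nonneg ht.le, mul_add]
        have : t ≤ δ * (1 / τ + |c|) := by
          have e3 : δ * (1 / τ + |c|) = δ / τ + δ * |c| := by ring
          rw [e3]
          nlinarith [neg_abs_le c]
        have := mul_le_mul_of_nonneg_right this (norm_nonneg w)
        linarith
      · rw [inner_add_right, inner_smul_right, hv, mul_zero, zero_add, inner_smul_right]
        positivity

end Triangulation

/-! ### Measurability, a determinant, and the charts -/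

/-- A finite family of measurable sets can be shrunk to a disjoint one with the same union. It
serves to count every point once that lies on several edges. -/
lemma exists_disjoint_measurableSet {ι α : Type*} [Fintype ι] [MeasurableSpace α] {E : ι → Set α}
    (hE : ∀ j, MeasurableSet (E j)) :
    ∃ A : ι → Set α, (∀ j, MeasurableSet (A j)) ∧ (∀ j, A j ⊆ E j) ∧ (⋃ j, A j = ⋃ j, E j) ∧
      Pairwise (Function.onFun Disjoint A) := by
  let e := Fintype.equivFin ι
  refine ⟨fun j => disjointed (fun k => E (e.symm k)) (e j), fun j => ?_, fun j => ?_, ?_, ?_⟩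
  · exact disjointedRec (fun _ _ ht => ht.diff (hE _)) (hE _)
  · simpa using disjointed_subset (fun k => E (e.symm k)) (e j)
  · rw [e.surjective.iUnion_comp (fun k => disjointed (fun k => E (e.symm k)) k),
      iUnion_disjointed, e.symm.surjective.iUnion_comp]
  · intro j k hjk
    exact disjoint_disjointed _ (fun h => hjk (e.injective h))

/-- For compact `I` the set is closed, and an open `I` is a countable union of compact sets. -/
lemma measurableSet_exists_add_smul_mem {K : Set E3} (hK : IsClosed K) {I : Set ℝ}
    (hI : IsOpen I) : MeasurableSet {p : E3 × E3 | ∃ t ∈ I, p.1 + t • p.2 ∈ K} := by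
  have hc : IsSigmaCompact I := by
    obtain ⟨F, hF, -, hFI, -⟩ := hI.exists_iUnion_isClosed
    rw [← hFI]
    exact isSigmaCompact_iUnion _ fun n => isSigmaCompact_univ.of_isClosed_subset (hF n)
      (Set.subset_univ _)
  obtain ⟨A, hA, rfl⟩ := hc
  have : {p : E3 × E3 | ∃ t ∈ ⋃ n, A n, p.1 + t • p.2 ∈ K}
      = ⋃ n, {p : E3 × E3 | ∃ t ∈ A n, p.1 + t • p.2 ∈ K} := by
    ext p
    simp only [Set.mem_iUnion, Set.mem_ofPred_eq]
    tauto
  rw [this]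
  refine MeasurableSet.iUnion fun n => IsClosed.measurableSet ?_
  have := isCompact_iff_compactSpace.1 (hA n)
  have h2 : IsClosed {q : A n × (E3 × E3) | q.2.1 + (q.1 : ℝ) • q.2.2 ∈ K} :=
    hK.preimage (by fun_prop)
  convert isClosedMap_snd_of_compactSpace _ h2 using 1
  ext p
  simp

lemma measurableSet_occluded {O : Set E3} (hO : IsClosed O) :
    MeasurableSet {p : E3 × E3 | Occluded O p.1 p.2} :=
  measurableSet_exists_add_smul_mem hO isOpen_Ioi

lemma det_prod_smul_fst_add_smul_snd (a b c d : ℝ) :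
    ((a • ContinuousLinearMap.fst ℝ ℝ ℝ + b • ContinuousLinearMap.snd ℝ ℝ ℝ).prod
      (c • ContinuousLinearMap.fst ℝ ℝ ℝ + d • ContinuousLinearMap.snd ℝ ℝ ℝ)).det
      = a * d - b * c := by
  rw [ContinuousLinearMap.det, ← LinearMap.det_toMatrix (Module.Basis.finTwoProd ℝ),
    Matrix.det_fin_two]
  simp [LinearMap.toMatrix_apply]

/-- The derivative, in `(s, τ)`, of a coordinate of the projection of the point `a + s e` of a line
along `u + τ d` to the plane in which the coordinate with index `2` vanishes. -/
lemma hasFDerivAt_projection {α ε a₂ e₂ u d u₂ d₂ : ℝ} {q : ℝ × ℝ} (hq : u₂ + q.2 * d₂ ≠ 0) :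
    HasFDerivAt (fun q : ℝ × ℝ =>
        α + q.1 * ε - (a₂ + q.1 * e₂) / (u₂ + q.2 * d₂) * (u + q.2 * d))
      ((ε - e₂ / (u₂ + q.2 * d₂) * (u + q.2 * d)) • ContinuousLinearMap.fst ℝ ℝ ℝ
        + (-((a₂ + q.1 * e₂) / (u₂ + q.2 * d₂)) * (d - d₂ / (u₂ + q.2 * d₂) * (u + q.2 * d))) •
          ContinuousLinearMap.snd ℝ ℝ ℝ) q := by
  have h1 : HasFDerivAt (fun q : ℝ × ℝ => q.1) (ContinuousLinearMap.fst ℝ ℝ ℝ) q :=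
    hasFDerivAt_fst
  have h2 : HasFDerivAt (fun q : ℝ × ℝ => q.2) (ContinuousLinearMap.snd ℝ ℝ ℝ) q :=
    hasFDerivAt_snd
  have hinv := (hasDerivAt_inv hq).comp_hasFDerivAt q ((h2.mul_const d₂).const_add u₂)
  have := ((h1.mul_const ε).const_add α).sub
    ((((h1.mul_const e₂).const_add a₂).mul hinv).mul ((h2.mul_const d).const_add u))
  refine HasFDerivAt.congr_fderiv this ?_
  ext
  · simp
    field_simp
  · simp
    field_simp
    ring

/-- The Jacobian determinant of the projection, as a `3 × 3` determinant with columns `a`, `b`, `w`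
estimated term by term. -/
lemma abs_det_projection_mul_le {a₀ a₁ a₂ b₀ b₁ b₂ w₀ w₁ w₂ r A B C : ℝ} (hw : 0 < w₂)
    (hr : 0 ≤ r) (h1 : |a₀| ≤ A) (h2 : |a₁| ≤ A) (h3 : |a₂| ≤ A) (h4 : |b₀| ≤ B) (h5 : |b₁| ≤ B)
    (h6 : |b₂| ≤ B) (h7 : |w₀| ≤ C) (h8 : |w₁| ≤ C) (h9 : |w₂| ≤ C) :
    |(a₀ - a₂ / w₂ * w₀) * (-r * (b₁ - b₂ / w₂ * w₁))
      - (-r * (b₀ - b₂ / w₂ * w₀)) * (a₁ - a₂ / w₂ * w₁)| * w₂ ≤ 6 * (A * B * (r * C)) := by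
  have key : ∀ x y z : ℝ, |x| ≤ A → |y| ≤ B → |z| ≤ C → |x * y * z| ≤ A * B * C := by
    intro x y z hx hy hz
    rw [abs_mul, abs_mul]
    have hA := (abs_nonneg x).trans hx
    have hB := (abs_nonneg y).trans hy
    gcongr
  have e : ((a₀ - a₂ / w₂ * w₀) * (-r * (b₁ - b₂ / w₂ * w₁))
      - (-r * (b₀ - b₂ / w₂ * w₀)) * (a₁ - a₂ / w₂ * w₁)) * w₂
      = r * ((a₁ * b₀ * w₂ - a₀ * b₁ * w₂) + (a₀ * b₂ * w₁ - a₁ * b₂ * w₀)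
        + (a₂ * b₁ * w₀ - a₂ * b₀ * w₁)) := by
    field_simp
    ring
  rw [← abs_of_pos hw, ← abs_mul, abs_of_pos hw, e, abs_mul, abs_of_nonneg hr]
  have k1 := abs_le.1 (key _ _ _ h2 h4 h9)
  have k2 := abs_le.1 (key _ _ _ h1 h5 h9)
  have k3 := abs_le.1 (key _ _ _ h1 h6 h8)
  have k4 := abs_le.1 (key _ _ _ h2 h6 h7)
  have k5 := abs_le.1 (key _ _ _ h3 h5 h7)
  have k6 := abs_le.1 (key _ _ _ h3 h4 h8)
  have : |(a₁ * b₀ * w₂ - a₀ * b₁ * w₂) + (a₀ * b₂ * w₁ - a₁ * b₂ * w₀)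
        + (a₂ * b₁ * w₀ - a₂ * b₀ * w₁)| ≤ 6 * (A * B * C) := by
    rw [abs_le]; constructor <;> linarith
  calc _ ≤ r * (6 * (A * B * C)) := by gcongr
    _ = _ := by ring

namespace Triangulation

variable {O : Set E3} (T : Triangulation O)

/-- The orthonormal frame of the plane of the `i`-th face that defines the chart. -/
noncomputable def frame (i : Fin T.N) (k : Fin 2) : E3 :=
  InnerProductSpace.gramSchmidtNormed ℝ
    ![T.vert i 1 - T.vert i 0, T.vert i 2 - T.vert i 0] k

lemma orthonormal_frame (i : Fin T.N) : Orthonormal ℝ (T.frame i) :=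
  InnerProductSpace.gramSchmidtNormed_orthonormal (T.linearIndependent_sub_vert i)

lemma chart_eq (i : Fin T.N) (w : EuclideanSpace ℝ (Fin 2)) :
    T.chart i w = T.vert i 0 + ∑ k, w k • T.frame i k := rfl

lemma inner_frame_chart_sub (i : Fin T.N) (k : Fin 2) (w : EuclideanSpace ℝ (Fin 2)) :
    ⟪T.frame i k, T.chart i w - T.vert i 0⟫ = w k := by
  rw [chart_eq, add_sub_cancel_left]
  exact (T.orthonormal_frame i).inner_right_fintype _ k

lemma continuous_chart (i : Fin T.N) : Continuous (T.chart i) := by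
  unfold chart
  fun_prop

lemma isBounded_face (i : Fin T.N) : Bornology.IsBounded (T.face i) :=
  isBounded_convexHull.2 (Set.finite_range _).isBounded

/-- The surface measure of the `i`-th face. -/
noncomputable def faceMeasure (i : Fin T.N) : Measure E3 :=
  Measure.map (T.chart i) (volume.restrict (T.chart i ⁻¹' T.relInt i))

lemma surfaceMeasure_eq : T.surfaceMeasure = ∑ i, T.faceMeasure i := rfl

lemma faceMeasure_apply (i : Fin T.N) {Z : Set E3} (hZ : MeasurableSet Z) :
    T.faceMeasure i Z = volume (T.chart i ⁻¹' (Z ∩ T.relInt i)) := by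
  rw [faceMeasure, Measure.map_apply (T.continuous_chart i).measurable hZ,
    Measure.restrict_apply ((T.continuous_chart i).measurable hZ), Set.preimage_inter]

/-- Lebesgue measure of a plane region computed in the coordinates `(w 0, w 1)`. -/
lemma volume_le_of_forall_mem {B : Set (EuclideanSpace ℝ (Fin 2))} {C : Set (ℝ × ℝ)}
    (h : ∀ w ∈ B, (w 0, w 1) ∈ C) : volume B ≤ volume C := by
  have h1 := (EuclideanSpace.volume_preserving_symm_measurableEquiv_toLp (Fin 2))
  have h2 := volume_preserving_finTwoArrow ℝ
  rw [← h2.measure_preimage_equiv, ← h1.measure_preimage_equiv]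
  exact measure_mono fun w hw => h w hw

instance (i : Fin T.N) : IsFiniteMeasure (T.faceMeasure i) := by
  constructor
  rw [T.faceMeasure_apply i MeasurableSet.univ, Set.univ_inter]
  obtain ⟨R, hR⟩ := (T.isBounded_face i).subset_closedBall (T.vert i 0)
  have hle := volume_le_of_forall_mem (B := T.chart i ⁻¹' T.relInt i)
    (C := Set.Icc (-R) R ×ˢ Set.Icc (-R) R) (fun w hw => by
      have h : ‖T.chart i w - T.vert i 0‖ ≤ R := by
        simpa [dist_eq_norm] using hR (T.relInt_subset_face i hw)
      have hk : ∀ k, w k ∈ Set.Icc (-R) R := fun k => by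
        rw [← abs_le.trans Set.mem_Icc.symm, ← T.inner_frame_chart_sub i k w]
        refine (abs_real_inner_le_norm _ _).trans ?_
        rw [(T.orthonormal_frame i).norm_eq_one, one_mul]
        exact h
      exact ⟨hk 0, hk 1⟩)
  refine hle.trans_lt ?_
  exact (isCompact_Icc.prod isCompact_Icc).measure_lt_top

end Triangulation

/-! ### The regions swept by the shadows of the edges -/

namespace Triangulation

variable {O : Set E3} (T : Triangulation O)

/-- The unit vector along an edge. -/
noncomputable def edgeDir (j : Fin T.N × Fin 3) : E3 :=
  ‖T.vert j.1 (j.2 + 1) - T.vert j.1 j.2‖⁻¹ • (T.vert j.1 (j.2 + 1) - T.vert j.1 j.2)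

/-- The parametrization by arc length of the line through an edge. -/
noncomputable def edgePoint (j : Fin T.N × Fin 3) (s : ℝ) : E3 :=
  T.vert j.1 j.2 + s • T.edgeDir j

lemma norm_edgeDir (j : Fin T.N × Fin 3) : ‖T.edgeDir j‖ = 1 := by
  have h : T.vert j.1 (j.2 + 1) - T.vert j.1 j.2 ≠ 0 := by
    rw [sub_ne_zero]
    intro h
    have := (T.affineIndependent_vert j.1).injective h
    simp at this
  rw [edgeDir, norm_smul, norm_inv, norm_norm, inv_mul_cancel₀ (norm_ne_zero_iff.2 h)]

lemma isometry_edgePoint (j : Fin T.N × Fin 3) : Isometry (T.edgePoint j) := by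
  refine Isometry.of_dist_eq fun s t => ?_
  rw [edgePoint, edgePoint, dist_add_left, dist_eq_norm, ← sub_smul, norm_smul, norm_edgeDir,
    mul_one, Real.dist_eq, Real.norm_eq_abs]

lemma exists_edgePoint_eq {j : Fin T.N × Fin 3} {y : E3} (hy : y ∈ T.edge j) :
    ∃ s, T.edgePoint j s = y := by
  have hne : ‖T.vert j.1 (j.2 + 1) - T.vert j.1 j.2‖ ≠ 0 := by
    intro h
    have := T.norm_edgeDir j
    simp [edgeDir, h] at this
  rw [edge, segment_eq_image'] at hy
  obtain ⟨t, -, rfl⟩ := hy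
  refine ⟨t * ‖T.vert j.1 (j.2 + 1) - T.vert j.1 j.2‖, ?_⟩
  rw [edgePoint, edgeDir, smul_smul, mul_assoc, mul_inv_cancel₀ hne, mul_one]

/-- The parameter of the point of the line `y - ℝ w` in the plane of the `i`-th face. -/
noncomputable def rayLength (i : Fin T.N) (y w : E3) : ℝ :=
  ⟪T.normal i, y - T.vert i 0⟫ / ⟪T.normal i, w⟫

/-- The projection of `y` along `w` to the plane of the `i`-th face. -/
noncomputable def source (i : Fin T.N) (y w : E3) : E3 := y - T.rayLength i y w • w

/-- The point `y` casts a shadow in direction `- w` on a point `x` of the `i`-th face: it is the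
first point of the boundary on the ray from `x` in direction `w`, and `x` is the limit of
a sequence of points of the face that are not occluded. That the sequence is explicit
makes this a measurable condition; it approaches `x` along the trace on the face of the plane
spanned by `w` and `d`, where `d` is the velocity of `w`. -/
def IsCaster (i : Fin T.N) (d y w : E3) : Prop :=
  0 < ⟪T.normal i, w⟫ ∧ 0 < T.rayLength i y w ∧ T.source i y w ∈ T.relInt i ∧ y ∈ frontier O ∧
    (¬ ∃ t ∈ Set.Ioo (0 : ℝ) 1, T.source i y w + t • (T.rayLength i y w • w) ∈ frontier O) ∧
    ∀ N : ℕ, ∃ k ≥ N,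
      T.source i y w + (1 / ((k : ℝ) + 1)) • ((⟪T.normal i, d⟫ / ⟪T.normal i, w⟫) • w - d)
        ∈ T.relInt i ∧
      ¬ Occluded O (T.source i y w +
        (1 / ((k : ℝ) + 1)) • ((⟪T.normal i, d⟫ / ⟪T.normal i, w⟫) • w - d)) w

lemma measurable_rayLength (i : Fin T.N) :
    Measurable fun p : E3 × E3 => T.rayLength i p.1 p.2 := by
  unfold rayLength
  fun_prop

lemma measurable_source (i : Fin T.N) : Measurable fun p : E3 × E3 => T.source i p.1 p.2 :=
  measurable_fst.sub ((T.measurable_rayLength i).smul measurable_snd)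

lemma measurableSet_isCaster (hO : IsClosed O) (i : Fin T.N) (d : E3) :
    MeasurableSet {p : E3 × E3 | T.IsCaster i d p.1 p.2} := by
  have hr := T.measurable_rayLength i
  have hs := T.measurable_source i
  have hn : Measurable fun p : E3 × E3 => ⟪T.normal i, p.2⟫ := by fun_prop
  have hk : ∀ k : ℕ, Measurable fun p : E3 × E3 => T.source i p.1 p.2 +
      (1 / ((k : ℝ) + 1)) • ((⟪T.normal i, d⟫ / ⟪T.normal i, p.2⟫) • p.2 - d) := fun k => by
    have hv : Measurable fun p : E3 × E3 =>
        (⟪T.normal i, d⟫ / ⟪T.normal i, p.2⟫) • p.2 - d := by fun_prop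
    exact hs.add (hv.const_smul (1 / ((k : ℝ) + 1)))
  refine (measurableSet_lt measurable_const hn).inter
    ((measurableSet_lt measurable_const hr).inter
    ((hs (T.measurableSet_relInt i)).inter
    ((measurable_fst isClosed_frontier.measurableSet).inter
    (((hs.prodMk (hr.smul measurable_snd))
      (measurableSet_exists_add_smul_mem isClosed_frontier isOpen_Ioo)).compl.inter ?_))))
  have : {p : E3 × E3 | ∀ N : ℕ, ∃ k ≥ N,
      T.source i p.1 p.2 + (1 / ((k : ℝ) + 1)) •
        ((⟪T.normal i, d⟫ / ⟪T.normal i, p.2⟫) • p.2 - d) ∈ T.relInt i ∧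
      ¬ Occluded O (T.source i p.1 p.2 +
        (1 / ((k : ℝ) + 1)) • ((⟪T.normal i, d⟫ / ⟪T.normal i, p.2⟫) • p.2 - d)) p.2}
      = ⋂ N : ℕ, ⋃ k : ℕ, ⋃ _ : k ≥ N, {p : E3 × E3 |
      T.source i p.1 p.2 + (1 / ((k : ℝ) + 1)) •
        ((⟪T.normal i, d⟫ / ⟪T.normal i, p.2⟫) • p.2 - d) ∈ T.relInt i ∧
      ¬ Occluded O (T.source i p.1 p.2 +
        (1 / ((k : ℝ) + 1)) • ((⟪T.normal i, d⟫ / ⟪T.normal i, p.2⟫) • p.2 - d)) p.2} := by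
    ext p
    simp only [Set.mem_iInter, Set.mem_iUnion, Set.mem_ofPred_eq, exists_prop]
  change MeasurableSet {p : E3 × E3 | ∀ N : ℕ, ∃ k ≥ N, _ ∧ _}
  rw [this]
  refine MeasurableSet.iInter fun N => MeasurableSet.iUnion fun k => MeasurableSet.iUnion fun _ =>
    ((hk k) (T.measurableSet_relInt i)).inter ?_
  exact (((hk k).prodMk measurable_snd) (measurableSet_occluded hO)).compl

variable {T}

lemma IsCaster.ne_zero {i : Fin T.N} {d y w : E3} (h : T.IsCaster i d y w) : w ≠ 0 := by
  rintro rfl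
  simpa using h.1

lemma source_add_rayLength_smul {i : Fin T.N} {y w : E3} :
    T.source i y w + T.rayLength i y w • w = y := sub_add_cancel _ _

lemma IsCaster.notMem {i : Fin T.N} {d y w : E3} (h : T.IsCaster i d y w) :
    ∀ t ∈ Set.Ioo 0 (T.rayLength i y w), T.source i y w + t • w ∉ frontier O := by
  rintro t ⟨h0, h1⟩ hmem
  have hr := h.2.1
  refine h.2.2.2.2.1 ⟨t / T.rayLength i y w, ⟨by positivity, by rwa [div_lt_one hr]⟩, ?_⟩
  rwa [smul_smul, div_mul_cancel₀ _ hr.ne']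

lemma IsCaster.mem_shadowEdges (hO : IsClosed O) {ρ : E3 → ℝ} (hρ : ∀ x ∈ frontier O, 0 < ρ x)
    {i : Fin T.N} {d y w : E3} (h : T.IsCaster i d y w) : y ∈ T.shadowEdges ρ w := by
  have hfirst := h.notMem
  obtain ⟨hw, hr, hx, hy, -, hlim⟩ := h
  have hret := isShadowRetraction_of_forall_notMem (x := T.source i y w) (w := w) hr
    (by rwa [source_add_rayLength_smul]) hfirst
  rw [source_add_rayLength_smul] at hret
  refine ⟨T.source i y w, T.mem_castBoundary hO hρ hx hw ⟨_, hr, ?_⟩ ?_, hret⟩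
  · rw [source_add_rayLength_smul]
    exact hO.frontier_subset hy
  · choose k hk hk' using hlim
    have h1 : Filter.Tendsto (fun N => 1 / ((k N : ℝ) + 1)) Filter.atTop (nhds 0) :=
      tendsto_one_div_add_atTop_nhds_zero_nat.comp
        (Filter.tendsto_atTop_mono hk Filter.tendsto_id)
    refine mem_closure_of_tendsto (b := Filter.atTop) (f := fun N => T.source i y w +
      (1 / ((k N : ℝ) + 1)) • ((⟪T.normal i, d⟫ / ⟪T.normal i, w⟫) • w - d)) ?_
      (Filter.Eventually.of_forall hk')
    simpa using (h1.smul_const ((⟪T.normal i, d⟫ / ⟪T.normal i, w⟫) • w - d)).const_add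
      (T.source i y w)

/-- A point casts its shadow on one face only, since the shadow does not go on behind the face
which it falls on. -/
lemma IsCaster.unique {i i' : Fin T.N} {d d' y w : E3} (h : T.IsCaster i d y w)
    (h' : T.IsCaster i' d' y w) : i = i' := by
  have key : ∀ {i i' : Fin T.N} {d d' : E3}, T.IsCaster i d y w → T.IsCaster i' d' y w →
      ¬ T.rayLength i y w < T.rayLength i' y w := by
    intro i i' d d' h h' hlt
    refine h'.notMem (T.rayLength i' y w - T.rayLength i y w)
      ⟨by linarith, by linarith [h.2.1]⟩ ?_
    convert T.relInt_subset_frontier i h.2.2.1 using 1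
    rw [source, source]
    module
  by_contra hne
  refine Set.disjoint_left.1 (T.relInt_disjoint hne) h.2.2.1 ?_
  have := le_antisymm (not_lt.1 (key h' h)) (not_lt.1 (key h h'))
  rw [source, this]
  exact h'.2.2.1

variable (T)

/-- The pairs of a parameter `s` on an edge and a time `τ ∈ [0, 1]` such that at time `τ`, when
the direction is `u + τ d`, the point of the edge belongs to `A` and casts a shadow on the `i`-th
face. -/
def castSet (A : Set E3) (i : Fin T.N) (j : Fin T.N × Fin 3) (u d : E3) : Set (ℝ × ℝ) :=
  {q | q.2 ∈ Set.Icc (0 : ℝ) 1 ∧ T.edgePoint j q.1 ∈ A ∧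
    T.IsCaster i d (T.edgePoint j q.1) (u + q.2 • d)}

lemma measurable_edgePoint (j : Fin T.N × Fin 3) : Measurable (T.edgePoint j) :=
  (T.isometry_edgePoint j).continuous.measurable

lemma measurableSet_castSet (hO : IsClosed O) {A : Set E3} (hA : MeasurableSet A) (i : Fin T.N)
    (j : Fin T.N × Fin 3) (u d : E3) : MeasurableSet (T.castSet A i j u d) := by
  have h1 : Measurable fun q : ℝ × ℝ => T.edgePoint j q.1 :=
    (T.measurable_edgePoint j).comp measurable_fst
  have h2 : Measurable fun q : ℝ × ℝ => u + q.2 • d := by fun_prop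
  exact (measurable_snd measurableSet_Icc).inter ((h1 hA).inter
    ((h1.prodMk h2) (T.measurableSet_isCaster hO i d)))

/-- At each time the casting points form a part of the shadow-casting edge points, whence
a bound for the total measure of the parameters. -/
lemma sum_volume_castSet_le (hO : IsClosed O) {ρ : E3 → ℝ} (hρ : ∀ x ∈ frontier O, 0 < ρ x)
    {A : Fin T.N × Fin 3 → Set E3} (hA : ∀ j, MeasurableSet (A j))
    (hAd : Pairwise (Function.onFun Disjoint A)) (u d : E3) :
    ∑ i, ∑ j, volume (T.castSet (A j) i j u d) ≤ T.maxShadowEdgeLength ρ := by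
  have hm : ∀ i j, MeasurableSet (T.castSet (A j) i j u d) := fun i j =>
    T.measurableSet_castSet hO (hA j) i j u d
  have hslice : ∀ τ : ℝ, ∑ p : Fin T.N × (Fin T.N × Fin 3),
      volume ((fun s => (s, τ)) ⁻¹' T.castSet (A p.2) p.1 p.2 u d)
      ≤ (Set.Icc (0 : ℝ) 1).indicator (fun _ => T.maxShadowEdgeLength ρ) τ := by
    intro τ
    by_cases hτ : τ ∈ Set.Icc (0 : ℝ) 1
    swap
    · have : ∀ p : Fin T.N × (Fin T.N × Fin 3),
          (fun s => (s, τ)) ⁻¹' T.castSet (A p.2) p.1 p.2 u d = ∅ := fun p =>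
        Set.eq_empty_of_forall_notMem fun s hs => hτ hs.1
      simp [this]
    rw [Set.indicator_of_mem hτ]
    set w := u + τ • d with hw
    let B : Fin T.N × (Fin T.N × Fin 3) → Set E3 := fun p =>
      T.edgePoint p.2 '' ((fun s => (s, τ)) ⁻¹' T.castSet (A p.2) p.1 p.2 u d)
    have hB : ∀ p, volume ((fun s => (s, τ)) ⁻¹' T.castSet (A p.2) p.1 p.2 u d)
        = Measure.hausdorffMeasure 1 (B p) := fun p => by
      rw [(T.isometry_edgePoint p.2).hausdorffMeasure_image (Or.inl zero_le_one),
        hausdorffMeasure_real]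
    have hBm : ∀ p, MeasurableSet (B p) := fun p =>
      (T.isometry_edgePoint p.2).isClosedEmbedding.measurableEmbedding.measurableSet_image.2
        (measurable_prodMk_right (hm _ _))
    have hBd : Pairwise (Function.onFun Disjoint B) := by
      rintro ⟨i, j⟩ ⟨i', j'⟩ hne
      refine Set.disjoint_left.2 ?_
      rintro y ⟨s, hs, rfl⟩ ⟨s', hs', hss⟩
      obtain ⟨-, hA1, hc⟩ := hs
      obtain ⟨-, hA2, hc'⟩ := hs'
      simp only at hA1 hA2 hc hc' hss
      rw [hss] at hA2 hc'
      have hj : j = j' := by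
        by_contra h
        exact Set.disjoint_left.1 (hAd h) hA1 hA2
      exact hne (Prod.ext (hc.unique hc') hj)
    simp_rw [hB]
    rw [← tsum_fintype (L := SummationFilter.unconditional _), ← measure_iUnion hBd hBm]
    rcases eq_or_ne w 0 with hw0 | hw0
    · have : ∀ p, B p = ∅ := fun p => Set.eq_empty_of_forall_notMem (by
        rintro _ ⟨s, hs, rfl⟩
        exact hs.2.2.ne_zero hw0)
      simp [this]
    · refine (measure_mono (Set.iUnion_subset ?_)).trans
        (T.hausdorffMeasure_shadowEdges_le ρ hw0)
      rintro p _ ⟨s, hs, rfl⟩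
      exact hs.2.2.mem_shadowEdges hO hρ
  calc ∑ i, ∑ j, volume (T.castSet (A j) i j u d)
      = ∑ p : Fin T.N × (Fin T.N × Fin 3), volume (T.castSet (A p.2) p.1 p.2 u d) := by
        rw [Fintype.sum_prod_type]
    _ = ∫⁻ τ, ∑ p : Fin T.N × (Fin T.N × Fin 3),
          volume ((fun s => (s, τ)) ⁻¹' T.castSet (A p.2) p.1 p.2 u d) := by
        rw [lintegral_finsetSum _ fun p _ => measurable_measure_prodMk_right (hm _ _)]
        refine Finset.sum_congr rfl fun p _ => ?_
        rw [Measure.volume_eq_prod, Measure.prod_apply_symm (hm _ _)]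
    _ ≤ ∫⁻ τ, (Set.Icc (0 : ℝ) 1).indicator (fun _ => T.maxShadowEdgeLength ρ) τ :=
        lintegral_mono hslice
    _ = T.maxShadowEdgeLength ρ := by
        rw [lintegral_indicator measurableSet_Icc]
        simp

/-- The coordinates, in the chart of the `i`-th face, of the shadow of a point of the `j`-th edge
at time `τ`, as a function of the arc length `s` on the edge and of `τ`. -/
noncomputable def shadowMap (i : Fin T.N) (j : Fin T.N × Fin 3) (u d : E3) (q : ℝ × ℝ) : ℝ × ℝ :=
  (⟪T.frame i 0, T.source i (T.edgePoint j q.1) (u + q.2 • d) - T.vert i 0⟫,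
    ⟪T.frame i 1, T.source i (T.edgePoint j q.1) (u + q.2 • d) - T.vert i 0⟫)

/-- The Jacobian of the shadow map, multiplied by the cosine of the angle of incidence, is at most
a multiple of `‖d‖` times the distance from a point to its shadow. -/
lemma exists_hasFDerivAt_shadowMap (i : Fin T.N) (j : Fin T.N × Fin 3) (u d : E3) {q : ℝ × ℝ}
    (hw : 0 < ⟪T.normal i, u + q.2 • d⟫)
    (hr : 0 ≤ T.rayLength i (T.edgePoint j q.1) (u + q.2 • d)) :
    ∃ f' : ℝ × ℝ →L[ℝ] ℝ × ℝ, HasFDerivAt (T.shadowMap i j u d) f' q ∧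
      |f'.det| * ⟪T.normal i, u + q.2 • d⟫ ≤
        6 * (‖d‖ * (T.rayLength i (T.edgePoint j q.1) (u + q.2 • d) * ‖u + q.2 • d‖)) := by
  have hcoord : ∀ b : E3, (fun q : ℝ × ℝ =>
      ⟪b, T.source i (T.edgePoint j q.1) (u + q.2 • d) - T.vert i 0⟫) = fun q =>
      ⟪b, T.vert j.1 j.2 - T.vert i 0⟫ + q.1 * ⟪b, T.edgeDir j⟫
        - (⟪T.normal i, T.vert j.1 j.2 - T.vert i 0⟫ + q.1 * ⟪T.normal i, T.edgeDir j⟫) /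
          (⟪T.normal i, u⟫ + q.2 * ⟪T.normal i, d⟫) * (⟪b, u⟫ + q.2 * ⟪b, d⟫) := by
    intro b
    funext q
    simp only [source, rayLength, edgePoint, inner_sub_right, inner_add_right, inner_smul_right]
    ring
  have hw' : ⟪T.normal i, u + q.2 • d⟫ = ⟪T.normal i, u⟫ + q.2 * ⟪T.normal i, d⟫ := by
    rw [inner_add_right, inner_smul_right]
  have hne : ⟪T.normal i, u⟫ + q.2 * ⟪T.normal i, d⟫ ≠ 0 := hw' ▸ hw.ne'
  have h0 := hasFDerivAt_projection (α := ⟪T.frame i 0, T.vert j.1 j.2 - T.vert i 0⟫)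
    (ε := ⟪T.frame i 0, T.edgeDir j⟫) (a₂ := ⟪T.normal i, T.vert j.1 j.2 - T.vert i 0⟫)
    (e₂ := ⟪T.normal i, T.edgeDir j⟫) (u := ⟪T.frame i 0, u⟫) (d := ⟪T.frame i 0, d⟫) hne
  have h1 := hasFDerivAt_projection (α := ⟪T.frame i 1, T.vert j.1 j.2 - T.vert i 0⟫)
    (ε := ⟪T.frame i 1, T.edgeDir j⟫) (a₂ := ⟪T.normal i, T.vert j.1 j.2 - T.vert i 0⟫)
    (e₂ := ⟪T.normal i, T.edgeDir j⟫) (u := ⟪T.frame i 1, u⟫) (d := ⟪T.frame i 1, d⟫) hne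
  rw [← hcoord] at h0 h1
  refine ⟨_, h0.prodMk h1, ?_⟩
  have hr' : T.rayLength i (T.edgePoint j q.1) (u + q.2 • d) =
      (⟪T.normal i, T.vert j.1 j.2 - T.vert i 0⟫ + q.1 * ⟪T.normal i, T.edgeDir j⟫) /
          (⟪T.normal i, u⟫ + q.2 * ⟪T.normal i, d⟫) := by
    simp only [rayLength, edgePoint, inner_sub_right, inner_add_right, inner_smul_right]
    ring
  have hle : ∀ b : E3, ‖b‖ = 1 → ∀ z : E3, |⟪b, z⟫| ≤ ‖z‖ := fun b hb z => by
    simpa [hb] using abs_real_inner_le_norm b z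
  have hf := (T.orthonormal_frame i).norm_eq_one
  have hbound := abs_det_projection_mul_le
    (a₀ := ⟪T.frame i 0, T.edgeDir j⟫) (a₁ := ⟪T.frame i 1, T.edgeDir j⟫)
    (b₀ := ⟪T.frame i 0, d⟫) (b₁ := ⟪T.frame i 1, d⟫)
    (w₀ := ⟪T.frame i 0, u + q.2 • d⟫) (w₁ := ⟪T.frame i 1, u + q.2 • d⟫)
    hw hr (hle _ (hf 0) _) (hle _ (hf 1) _) (hle _ (T.norm_normal i) (T.edgeDir j))
    (hle _ (hf 0) _) (hle _ (hf 1) _) (hle _ (T.norm_normal i) d)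
    (hle _ (hf 0) _) (hle _ (hf 1) _) (hle _ (T.norm_normal i) _)
  rw [norm_edgeDir, one_mul] at hbound
  refine le_of_eq_of_le ?_ hbound
  rw [det_prod_smul_fst_add_smul_snd, hw', ← hr']
  simp only [inner_add_right, inner_smul_right]

/-- The area swept by the shadow of an edge. -/
lemma volume_shadowMap_image_le (hO : IsCompact O) {A : Set E3} (hA : MeasurableSet A)
    (i : Fin T.N) (j : Fin T.N × Fin 3) (u d : E3) {m : ℝ}
    (hm : ∀ τ ∈ Set.Icc (0 : ℝ) 1, m ≤ ⟪T.normal i, u + τ • d⟫) :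
    ENNReal.ofReal m * volume (T.shadowMap i j u d '' T.castSet A i j u d)
      ≤ ENNReal.ofReal (6 * (‖d‖ * Metric.diam O)) * volume (T.castSet A i j u d) := by
  have hex : ∀ q ∈ T.castSet A i j u d, ∃ f' : ℝ × ℝ →L[ℝ] ℝ × ℝ,
      HasFDerivAt (T.shadowMap i j u d) f' q ∧ m * |f'.det| ≤ 6 * (‖d‖ * Metric.diam O) := by
    rintro q ⟨hτ, -, hc⟩
    obtain ⟨f', hf, hle⟩ := T.exists_hasFDerivAt_shadowMap i j u d hc.1 hc.2.1.le
    refine ⟨f', hf, ?_⟩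
    have h1 : T.rayLength i (T.edgePoint j q.1) (u + q.2 • d) * ‖u + q.2 • d‖
        ≤ Metric.diam O := by
      have := Metric.dist_le_diam_of_mem hO.isBounded (hO.isClosed.frontier_subset hc.2.2.2.1)
        (hO.isClosed.frontier_subset (T.relInt_subset_frontier i hc.2.2.1))
      rwa [source, dist_eq_norm, sub_sub_cancel, norm_smul, Real.norm_of_nonneg hc.2.1.le] at this
    calc m * |f'.det| ≤ ⟪T.normal i, u + q.2 • d⟫ * |f'.det| := by
          gcongr
          exact hm _ hτ
      _ ≤ 6 * (‖d‖ * (T.rayLength i (T.edgePoint j q.1) (u + q.2 • d) * ‖u + q.2 • d‖)) := by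
          rw [mul_comm]
          exact hle
      _ ≤ _ := by gcongr
  have hms := T.measurableSet_castSet hO.isClosed hA i j u d
  choose! f' hf hle using hex
  calc ENNReal.ofReal m * volume (T.shadowMap i j u d '' T.castSet A i j u d)
      ≤ ENNReal.ofReal m * ∫⁻ q in T.castSet A i j u d, ENNReal.ofReal |(f' q).det| := by
        gcongr
        exact addHaar_image_le_lintegral_abs_det_fderiv volume hms
          fun q hq => (hf q hq).hasFDerivWithinAt
    _ = ∫⁻ q in T.castSet A i j u d, ENNReal.ofReal m * ENNReal.ofReal |(f' q).det| :=
        (lintegral_const_mul' _ _ ENNReal.ofReal_ne_top).symm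
    _ ≤ ∫⁻ q in T.castSet A i j u d, ENNReal.ofReal (6 * (‖d‖ * Metric.diam O)) := by
        refine setLIntegral_mono measurable_const fun q hq => ?_
        rw [← ENNReal.ofReal_mul' (abs_nonneg _)]
        exact ENNReal.ofReal_le_ofReal (hle q hq)
    _ = _ := by rw [setLIntegral_const]

/-- The part of the `i`-th face that faces both `u` and `u'` and is occluded in
direction `u'`, but not in direction `u`. -/
def newlyOccluded (i : Fin T.N) (u u' : E3) : Set E3 :=
  {x | x ∈ T.relInt i ∧ 0 < ⟪T.normal i, u⟫ ∧ 0 < ⟪T.normal i, u'⟫ ∧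
    ¬ Occluded O x u ∧ Occluded O x u'}

lemma measurableSet_setOf_occluded (hO : IsClosed O) (w : E3) :
    MeasurableSet {x | Occluded O x w} :=
  measurable_prodMk_right (measurableSet_occluded hO)

lemma measurableSet_newlyOccluded (hO : IsClosed O) (i : Fin T.N) (u u' : E3) :
    MeasurableSet (T.newlyOccluded i u u') :=
  (T.measurableSet_relInt i).inter ((MeasurableSet.const _).inter ((MeasurableSet.const _).inter
    ((measurableSet_setOf_occluded hO u).compl.inter (measurableSet_setOf_occluded hO u'))))

/-- The newly occluded part of a face is swept by the shadows of the edges. -/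
lemma exists_mem_castSet (hO : IsCompact O) {ρ : E3 → ℝ} (hρ : ∀ x ∈ frontier O, 0 < ρ x)
    {A : Fin T.N × Fin 3 → Set E3} (hAE : ∀ j, A j ⊆ T.edge j) (hA : ⋃ j, A j = ⋃ j, T.edge j)
    {i : Fin T.N} {x u u' : E3} (hx : x ∈ T.newlyOccluded i u u') :
    ∃ j, ∃ q ∈ T.castSet (A j) i j u (u' - u),
      T.source i (T.edgePoint j q.1) (u + q.2 • (u' - u)) = x := by
  obtain ⟨hxi, hu, hu', hnocc, hocc⟩ := hx
  obtain ⟨τ, hτ, r, hr, hy, hfirst, hlim⟩ :=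
    T.exists_first_occlusion hO hxi hu hu' hnocc hocc
  set d := u' - u with hd
  set w := u + τ • d with hw
  have hnw : 0 < ⟪T.normal i, w⟫ :=
    (lt_min hu hu').trans_le (min_inner_le_inner_add_smul _ u u' hτ)
  have hrl : T.rayLength i (x + r • w) w = r := by
    have : x + r • w - T.vert i 0 = (x - T.vert i 0) + r • w := by abel
    rw [rayLength, this, inner_add_right, T.inner_normal_sub_of_mem_relInt hxi, inner_smul_right,
      zero_add, mul_div_cancel_right₀ _ hnw.ne']
  have hsrc : T.source i (x + r • w) w = x := by rw [source, hrl, add_sub_cancel_right]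
  have hcaster : T.IsCaster i d (x + r • w) w := by
    refine ⟨hnw, by rwa [hrl], by rwa [hsrc], hy, ?_, ?_⟩
    · rintro ⟨t, ⟨ht0, ht1⟩, htO⟩
      rw [hsrc, hrl, smul_smul] at htO
      exact hfirst (t * r) ⟨by positivity, by nlinarith⟩ htO
    · intro N
      rw [hsrc]
      have htend : Filter.Tendsto (fun k : ℕ => 1 / ((k : ℝ) + 1)) Filter.atTop
          (nhdsWithin 0 (Set.Ioi 0)) :=
        tendsto_nhdsWithin_iff.2 ⟨tendsto_one_div_add_atTop_nhds_zero_nat,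
          Filter.Eventually.of_forall fun k => Set.mem_Ioi.2 (by positivity)⟩
      obtain ⟨k, hk, hkN⟩ := ((htend.eventually hlim).and (Filter.eventually_ge_atTop N)).exists
      exact ⟨k, hkN, hk⟩
  have hyE := T.shadowEdges_subset hO.isClosed hρ w (hcaster.mem_shadowEdges hO.isClosed hρ)
  rw [← hA] at hyE
  obtain ⟨j, hj⟩ := Set.mem_iUnion.1 hyE
  obtain ⟨s, hs⟩ := T.exists_edgePoint_eq (hAE j hj)
  refine ⟨j, (s, τ), ⟨hτ, ?_, ?_⟩, ?_⟩
  · simpa only [hs] using hj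
  · simpa only [hs] using hcaster
  · simpa only [hs] using hsrc

/-- The total area of the newly occluded regions, weighted by a lower bound for the cosine of
the angle of incidence. -/
lemma sum_faceMeasure_newlyOccluded_le (hO : IsCompact O) {ρ : E3 → ℝ}
    (hρ : ∀ x ∈ frontier O, 0 < ρ x) (u u' : E3) :
    ∑ i, ENNReal.ofReal (min ⟪T.normal i, u⟫ ⟪T.normal i, u'⟫) *
        T.faceMeasure i (T.newlyOccluded i u u')
      ≤ ENNReal.ofReal (6 * (‖u' - u‖ * Metric.diam O)) * T.maxShadowEdgeLength ρ := by
  obtain ⟨A, hAm, hAE, hAU, hAd⟩ := exists_disjoint_measurableSet (E := T.edge) fun j => by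
    have : IsCompact (T.edge j) := by
      rw [edge, segment_eq_image']
      exact isCompact_Icc.image (by fun_prop)
    exact this.isClosed.measurableSet
  calc _ ≤ ∑ i, ∑ j, ENNReal.ofReal (6 * (‖u' - u‖ * Metric.diam O)) *
          volume (T.castSet (A j) i j u (u' - u)) := by
        refine Finset.sum_le_sum fun i _ => ?_
        have h1 : T.faceMeasure i (T.newlyOccluded i u u')
            ≤ ∑ j, volume (T.shadowMap i j u (u' - u) '' T.castSet (A j) i j u (u' - u)) := by
          rw [T.faceMeasure_apply i (T.measurableSet_newlyOccluded hO.isClosed i u u')]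
          refine le_trans (volume_le_of_forall_mem (C := ⋃ j,
            T.shadowMap i j u (u' - u) '' T.castSet (A j) i j u (u' - u)) ?_)
            (measure_iUnion_fintype_le _ _)
          rintro p ⟨hp, -⟩
          obtain ⟨j, q, hq, hqp⟩ := T.exists_mem_castSet hO hρ hAE hAU hp
          refine Set.mem_iUnion.2 ⟨j, q, hq, ?_⟩
          rw [shadowMap, hqp, inner_frame_chart_sub, inner_frame_chart_sub]
        refine (mul_le_mul_right h1 _).trans ?_
        rw [Finset.mul_sum]
        exact Finset.sum_le_sum fun j _ =>
          T.volume_shadowMap_image_le hO (hAm j) i j u (u' - u)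
            fun τ hτ => min_inner_le_inner_add_smul _ u u' hτ
    _ = ENNReal.ofReal (6 * (‖u' - u‖ * Metric.diam O)) *
          ∑ i, ∑ j, volume (T.castSet (A j) i j u (u' - u)) := by
        simp_rw [Finset.mul_sum]
    _ ≤ _ := by
        gcongr
        exact T.sum_volume_castSet_le hO.isClosed hρ hAm hAd u (u' - u)

end Triangulation

/-! ### The estimates -/

lemma abs_max_inner_sub_max_inner_le {n u u' : E3} (hn : ‖n‖ = 1) :
    |max ⟪n, u⟫ 0 - max ⟪n, u'⟫ 0| ≤ ‖u - u'‖ := by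
  refine (abs_max_sub_max_le_abs _ _ _).trans ?_
  rw [← inner_sub_right]
  simpa [hn] using abs_real_inner_le_norm n (u - u')

lemma le_maxAlbedo {O : Set E3} {ρ : E3 → ℝ} (hρ : ∀ x ∈ frontier O, 0 < ρ x ∧ ρ x ≤ 1)
    {x : E3} (hx : x ∈ frontier O) : ρ x ≤ maxAlbedo O ρ := by
  refine le_csSup ⟨1, ?_⟩ (Set.mem_image_of_mem ρ hx)
  rintro _ ⟨y, hy, rfl⟩
  exact (hρ y hy).2

/-- If a lit point gets occluded, then the square of its cosine is controlled by a lower bound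
`min a b` of the cosine during the turning. -/
lemma sq_le_of_abs_sub_le {a b δ : ℝ} (ha : 0 < a) (ha1 : a ≤ 1) (hb : 0 < b)
    (hab : |a - b| ≤ δ) : a ^ 2 ≤ 2 * δ ^ 2 + 2 * min a b := by
  have h1 : a ≤ min a b + δ := by
    rcases le_total a b with h | h
    · rw [min_eq_left h]
      linarith [(abs_nonneg _).trans hab]
    · rw [min_eq_right h]
      linarith [le_abs_self (a - b)]
  have h2 : 0 < min a b := lt_min ha hb
  have h3 : min a b ≤ 1 := (min_le_left _ _).trans ha1
  nlinarith [sq_nonneg (min a b - δ)]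

namespace Triangulation

variable {O : Set E3} (T : Triangulation O)

instance : IsFiniteMeasure T.surfaceMeasure := by
  constructor
  rw [surfaceMeasure_eq, Measure.finsetSum_apply]
  exact ENNReal.sum_lt_top.2 fun i _ => measure_lt_top _ _

lemma ae_mem_relInt (i : Fin T.N) : ∀ᵐ x ∂T.faceMeasure i, x ∈ T.relInt i := by
  rw [ae_iff]
  change T.faceMeasure i (T.relInt i)ᶜ = 0
  rw [T.faceMeasure_apply i (T.measurableSet_relInt i).compl, Set.compl_inter_self]
  simp

lemma ae_surfaceMeasure_of_forall_relInt {p : E3 → Prop} (h : ∀ i, ∀ x ∈ T.relInt i, p x) :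
    ∀ᵐ x ∂T.surfaceMeasure, p x := by
  rw [ae_iff, surfaceMeasure_eq, Measure.finsetSum_apply, Finset.sum_eq_zero_iff]
  intro i _
  exact ae_iff.1 ((T.ae_mem_relInt i).mono (h i))

lemma area_eq : T.area = ∑ i, (T.faceMeasure i).real Set.univ := by
  rw [area, surfaceMeasure_eq, Measure.finsetSum_apply,
    ENNReal.toReal_sum fun i _ => measure_ne_top _ _]
  refine Finset.sum_congr rfl fun i _ => ?_
  rw [Measure.real, T.faceMeasure_apply i isClosed_frontier.measurableSet,
    T.faceMeasure_apply i MeasurableSet.univ, Set.univ_inter,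
    Set.inter_eq_right.2 (T.relInt_subset_frontier i)]

lemma direct_eq_mul_sum (hO : IsClosed O) (ρ : E3 → ℝ) (w x : E3) :
    T.direct ρ w x = ρ x * ∑ i, (T.relInt i \ {x | Occluded O x w}).indicator
      (fun _ => max ⟪T.normal i, w⟫ 0) x := by
  by_cases hx : ∃ i, x ∈ T.relInt i
  · obtain ⟨i, hi⟩ := hx
    rw [T.direct_eq hO ρ hi, Finset.sum_eq_single i]
    · by_cases h : Occluded O x w <;> simp [h, hi]
    · intro j _ hji
      exact Set.indicator_of_notMem
        (fun h => Set.disjoint_left.1 (T.relInt_disjoint hji) h.1 hi) _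
    · simp
  · have hreg : x ∉ T.regularPart := fun h => hx (Set.mem_iUnion.1 h)
    rw [direct, if_neg hreg, Finset.sum_eq_zero, mul_zero]
    intro j _
    exact Set.indicator_of_notMem (fun h => hx ⟨j, h.1⟩) _

lemma memLp_direct (hO : IsClosed O) {ρ : E3 → ℝ} (hρ : ∀ x ∈ frontier O, 0 < ρ x ∧ ρ x ≤ 1)
    (hρm : AEMeasurable ρ T.surfaceMeasure) (w : E3) (p : ℝ≥0∞) :
    MemLp (T.direct ρ w) p T.surfaceMeasure := by
  refine MemLp.of_bound (C := ‖w‖) (AEMeasurable.aestronglyMeasurable ?_)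
    (T.ae_surfaceMeasure_of_forall_relInt fun i x hx => ?_)
  · rw [funext (T.direct_eq_mul_sum hO ρ w)]
    refine hρm.mul (Measurable.aemeasurable ?_)
    refine Finset.measurable_sum _ fun i _ => measurable_const.indicator ?_
    exact (T.measurableSet_relInt i).diff (measurableSet_setOf_occluded hO w)
  · rw [T.direct_eq hO ρ hx]
    obtain ⟨h0, h1⟩ := hρ x (T.relInt_subset_frontier i hx)
    have h2 : max ⟪T.normal i, w⟫ 0 ≤ ‖w‖ := by
      refine max_le ?_ (norm_nonneg w)
      simpa [T.norm_normal i] using real_inner_le_norm (T.normal i) w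
    have h3 : 0 ≤ max ⟪T.normal i, w⟫ 0 := le_max_right _ _
    split_ifs
    · simp
    · rw [mul_one, Real.norm_of_nonneg (by positivity)]
      nlinarith

/-- The difference of the direct reflectances at a point is of the order of the change of the
direction, unless the point is occluded in one direction only. -/
lemma sq_direct_sub_direct_le (hO : IsClosed O) {ρ : E3 → ℝ}
    (hρ : ∀ x ∈ frontier O, 0 < ρ x ∧ ρ x ≤ 1) {u u' : E3} (hu : ‖u‖ = 1) (hu' : ‖u'‖ = 1)
    {i : Fin T.N} {x : E3} (hx : x ∈ T.relInt i) :
    (T.direct ρ u x - T.direct ρ u' x) ^ 2 ≤ maxAlbedo O ρ ^ 2 * (2 * ‖u - u'‖ ^ 2 +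
      ((T.newlyOccluded i u u').indicator
          (fun _ => 2 * min ⟪T.normal i, u⟫ ⟪T.normal i, u'⟫) x +
        (T.newlyOccluded i u' u).indicator
          (fun _ => 2 * min ⟪T.normal i, u'⟫ ⟪T.normal i, u⟫) x)) := by
  have hxf := T.relInt_subset_frontier i hx
  rw [T.direct_eq hO ρ hx, T.direct_eq hO ρ hx, ← mul_sub, mul_pow]
  have hn := T.norm_normal i
  refine mul_le_mul (pow_le_pow_left₀ (hρ x hxf).1.le (le_maxAlbedo hρ hxf) 2) ?_
    (sq_nonneg _) (sq_nonneg _)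
  have hind : ∀ v v' : E3, 0 ≤ (T.newlyOccluded i v v').indicator
      (fun _ => 2 * min ⟪T.normal i, v⟫ ⟪T.normal i, v'⟫) x := by
    intro v v'
    refine Set.indicator_apply_nonneg fun h => ?_
    have := lt_min h.2.1 h.2.2.1
    positivity
  have hle1 : ∀ v : E3, ‖v‖ = 1 → ⟪T.normal i, v⟫ ≤ 1 := fun v hv => by
    simpa [hn, hv] using real_inner_le_norm (T.normal i) v
  -- a point that is visible from direction `v` only
  have hone : ∀ v v' : E3, ‖v‖ = 1 → ¬ Occluded O x v → Occluded O x v' →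
      max ⟪T.normal i, v⟫ 0 ^ 2 ≤ 2 * ‖v - v'‖ ^ 2 + (T.newlyOccluded i v v').indicator
        (fun _ => 2 * min ⟪T.normal i, v⟫ ⟪T.normal i, v'⟫) x := by
    intro v v' hv hocc hocc'
    have hd := abs_max_inner_sub_max_inner_le (u := v) (u' := v') hn
    rcases le_or_gt ⟪T.normal i, v⟫ 0 with h | h
    · rw [max_eq_right h]
      nlinarith [hind v v', sq_nonneg ‖v - v'‖]
    rcases le_or_gt ⟪T.normal i, v'⟫ 0 with h' | h'
    · rw [max_eq_right h', sub_zero] at hd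
      have h2 := pow_le_pow_left₀ (abs_nonneg _) hd 2
      rw [sq_abs] at h2
      nlinarith [hind v v', sq_nonneg ‖v - v'‖]
    · rw [Set.indicator_of_mem (show x ∈ T.newlyOccluded i v v' from ⟨hx, h, h', hocc, hocc'⟩)]
      rw [max_eq_left h.le, max_eq_left h'.le] at hd
      rw [max_eq_left h.le]
      exact sq_le_of_abs_sub_le h (hle1 v hv) h' hd
  have i1 := hind u u'
  have i2 := hind u' u
  by_cases h : Occluded O x u <;> by_cases h' : Occluded O x u'
  · simp only [h, h', if_true, mul_zero, sub_zero]
    nlinarith [sq_nonneg ‖u - u'‖]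
  · have := hone u' u hu' h' h
    rw [norm_sub_rev] at this
    simp only [h, h', if_true, if_false, mul_zero, mul_one, zero_sub, neg_sq]
    linarith
  · have := hone u u' hu h h'
    simp only [h, h', if_true, if_false, mul_zero, mul_one, sub_zero]
    linarith
  · simp only [h, h', if_false, mul_one]
    have h2 := pow_le_pow_left₀ (abs_nonneg _)
      (abs_max_inner_sub_max_inner_le (u := u) (u' := u') hn) 2
    rw [sq_abs] at h2
    nlinarith [sq_nonneg ‖u - u'‖]

/-- A convex object does not occlude the points of its faces from directions on their outer
side. -/
lemma not_occluded_of_convex (hconv : Convex ℝ O) (hO : IsClosed O) {i : Fin T.N} {x w : E3}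
    (hx : x ∈ T.relInt i) (hw : 0 < ⟪T.normal i, w⟫) : ¬ Occluded O x w := by
  rintro ⟨t, ht, htO⟩
  obtain ⟨ε, hε, hout⟩ := T.exists_forall_notMem hx
  obtain ⟨s, ⟨h1, h2⟩, hs⟩ := (((tendsto_add_smul_nhdsGT 0 (t • w)).eventually
    (Metric.ball_mem_nhds 0 hε)).and (Ioo_mem_nhdsGT one_pos)|>.and self_mem_nhdsWithin).exists
  have hs : 0 < s := hs
  rw [zero_add] at h1
  refine hout (s • t • w) (by simpa using h1) ?_ ?_
  · rw [inner_smul_right, inner_smul_right]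
    positivity
  · have := hconv.add_smul_sub_mem (hO.frontier_subset (T.relInt_subset_frontier i hx)) htO
      ⟨hs.le, h2.2.le⟩
    simpa using this

lemma sq_direct_sub_direct_le_of_convex (hconv : Convex ℝ O) (hO : IsClosed O) {ρ : E3 → ℝ}
    (hρ : ∀ x ∈ frontier O, 0 < ρ x ∧ ρ x ≤ 1) (u u' : E3)
    {i : Fin T.N} {x : E3} (hx : x ∈ T.relInt i) :
    (T.direct ρ u x - T.direct ρ u' x) ^ 2 ≤ maxAlbedo O ρ ^ 2 * ‖u - u'‖ ^ 2 := by
  have hxf := T.relInt_subset_frontier i hx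
  have hd : ∀ w, T.direct ρ w x = ρ x * max ⟪T.normal i, w⟫ 0 := by
    intro w
    rw [T.direct_eq hO ρ hx]
    rcases le_or_gt ⟪T.normal i, w⟫ 0 with h | h
    · simp [h]
    · rw [if_neg (T.not_occluded_of_convex hconv hO hx h), mul_one]
  rw [hd, hd, ← mul_sub, mul_pow]
  have h2 := pow_le_pow_left₀ (abs_nonneg _)
    (abs_max_inner_sub_max_inner_le (u := u) (u' := u') (T.norm_normal i)) 2
  rw [sq_abs] at h2
  exact mul_le_mul (pow_le_pow_left₀ (hρ x hxf).1.le (le_maxAlbedo hρ hxf) 2) h2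
    (sq_nonneg _) (sq_nonneg _)

lemma integral_surfaceMeasure_le {f : E3 → ℝ} (hf : Integrable f T.surfaceMeasure)
    {g : Fin T.N → E3 → ℝ} (hg : ∀ i, Integrable (g i) (T.faceMeasure i))
    (hfg : ∀ i, ∀ x ∈ T.relInt i, f x ≤ g i x) :
    ∫ x, f x ∂T.surfaceMeasure ≤ ∑ i, ∫ x, g i x ∂T.faceMeasure i := by
  rw [surfaceMeasure_eq] at hf ⊢
  have hfi : ∀ i, Integrable f (T.faceMeasure i) := fun i =>
    integrable_finsetSum_measure.1 hf i (Finset.mem_univ i)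
  rw [integral_finsetSum_measure fun i _ => hfi i]
  exact Finset.sum_le_sum fun i _ =>
    integral_mono_ae (hfi i) (hg i) ((T.ae_mem_relInt i).mono (hfg i))

lemma sum_real_newlyOccluded_le (hO : IsCompact O) {ρ : E3 → ℝ}
    (hρ : ∀ x ∈ frontier O, 0 < ρ x) (u u' : E3) :
    ∑ i, min ⟪T.normal i, u⟫ ⟪T.normal i, u'⟫ * (T.faceMeasure i).real (T.newlyOccluded i u u')
      ≤ 6 * (‖u' - u‖ * Metric.diam O) * (T.maxShadowEdgeLength ρ).toReal := by
  have hd : (0 : ℝ) ≤ Metric.diam O := Metric.diam_nonneg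
  have h := ENNReal.toReal_mono
    (ENNReal.mul_ne_top ENNReal.ofReal_ne_top (T.maxShadowEdgeLength_ne_top hO.isClosed hρ))
    (T.sum_faceMeasure_newlyOccluded_le hO hρ u u')
  rw [ENNReal.toReal_mul, ENNReal.toReal_ofReal (by positivity), ENNReal.toReal_sum fun i _ =>
    ENNReal.mul_ne_top ENNReal.ofReal_ne_top (measure_ne_top _ _)] at h
  refine le_trans (Finset.sum_le_sum fun i _ => ?_) h
  rw [ENNReal.toReal_mul, ENNReal.toReal_ofReal', Measure.real]
  gcongr
  exact le_max_left _ _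

end Triangulation

theorem theorem5p1 (O : Set E3) (hO : IsCompact O) (T : Triangulation O)
    (ρ : E3 → ℝ) (hρ : ∀ x ∈ frontier O, 0 < ρ x ∧ ρ x ≤ 1)
    (hρm : AEMeasurable ρ T.surfaceMeasure)
    (u u' : E3) (hu : ‖u‖ = 1) (hu' : ‖u'‖ = 1) (huu' : ‖u - u'‖ ≤ √2) :
    MemLp (T.direct ρ u) 2 T.surfaceMeasure ∧
    MemLp (T.direct ρ u') 2 T.surfaceMeasure ∧
    T.maxShadowEdgeLength ρ ≠ ∞ ∧
    (∫ x, (T.direct ρ u x - T.direct ρ u' x) ^ 2 ∂T.surfaceMeasure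
      ≤ 2 * maxAlbedo O ρ ^ 2 * T.area * ‖u - u'‖ ^ 2
        + 32 * √2 * maxAlbedo O ρ ^ 2 * Metric.diam O * (T.maxShadowEdgeLength ρ).toReal
          * ‖u - u'‖) ∧
    (Convex ℝ O →
      ∫ x, (T.direct ρ u x - T.direct ρ u' x) ^ 2 ∂T.surfaceMeasure
        ≤ maxAlbedo O ρ ^ 2 * T.area * ‖u - u'‖ ^ 2) := by
  have hOc := hO.isClosed
  have hpos : ∀ x ∈ frontier O, 0 < ρ x := fun x hx => (hρ x hx).1
  have hm := T.memLp_direct hOc hρ hρm u 2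
  have hm' := T.memLp_direct hOc hρ hρm u' 2
  have hint : Integrable (fun x => (T.direct ρ u x - T.direct ρ u' x) ^ 2) T.surfaceMeasure :=
    (hm.sub hm').integrable_sq
  refine ⟨hm, hm', T.maxShadowEdgeLength_ne_top hOc hpos, ?_, fun hconv => ?_⟩
  · have hind : ∀ v v' : E3, ∀ i, Integrable ((T.newlyOccluded i v v').indicator
        (fun _ => 2 * min ⟪T.normal i, v⟫ ⟪T.normal i, v'⟫)) (T.faceMeasure i) := fun v v' i =>
      (integrable_const _).indicator (T.measurableSet_newlyOccluded hOc i v v')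
    refine (T.integral_surfaceMeasure_le hint (fun i => ((integrable_const (2 * ‖u - u'‖ ^ 2)).add
      ((hind u u' i).add (hind u' u i))).const_mul (maxAlbedo O ρ ^ 2))
      fun i x hx => T.sq_direct_sub_direct_le hOc hρ hu hu' hx).trans ?_
    have hval : ∀ i, ∫ x, maxAlbedo O ρ ^ 2 * (2 * ‖u - u'‖ ^ 2 +
        ((T.newlyOccluded i u u').indicator
            (fun _ => 2 * min ⟪T.normal i, u⟫ ⟪T.normal i, u'⟫) x +
          (T.newlyOccluded i u' u).indicator
            (fun _ => 2 * min ⟪T.normal i, u'⟫ ⟪T.normal i, u⟫) x)) ∂T.faceMeasure i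
        = maxAlbedo O ρ ^ 2 * (2 * ‖u - u'‖ ^ 2 * (T.faceMeasure i).real Set.univ
          + (2 * (min ⟪T.normal i, u⟫ ⟪T.normal i, u'⟫ *
              (T.faceMeasure i).real (T.newlyOccluded i u u'))
            + 2 * (min ⟪T.normal i, u'⟫ ⟪T.normal i, u⟫ *
              (T.faceMeasure i).real (T.newlyOccluded i u' u)))) := by
      intro i
      have hsum : Integrable (fun x => (T.newlyOccluded i u u').indicator
          (fun _ => 2 * min ⟪T.normal i, u⟫ ⟪T.normal i, u'⟫) x +
          (T.newlyOccluded i u' u).indicator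
          (fun _ => 2 * min ⟪T.normal i, u'⟫ ⟪T.normal i, u⟫) x) (T.faceMeasure i) :=
        (hind u u' i).add (hind u' u i)
      rw [integral_const_mul, integral_add (integrable_const _) hsum,
        integral_add (hind u u' i) (hind u' u i), integral_const,
        integral_indicator_const _ (T.measurableSet_newlyOccluded hOc i u u'),
        integral_indicator_const _ (T.measurableSet_newlyOccluded hOc i u' u)]
      simp only [smul_eq_mul]
      ring
    refine (Finset.sum_congr rfl fun i _ => hval i).trans_le ?_
    rw [← Finset.mul_sum, Finset.sum_add_distrib, Finset.sum_add_distrib, ← Finset.mul_sum,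
      ← Finset.mul_sum, ← Finset.mul_sum, ← T.area_eq]
    have h1 := T.sum_real_newlyOccluded_le hO hpos u u'
    have h2 := T.sum_real_newlyOccluded_le hO hpos u' u
    rw [norm_sub_rev] at h1
    have hsqrt : 1 ≤ √2 := Real.one_le_sqrt.2 (by norm_num)
    have hX : 0 ≤ maxAlbedo O ρ ^ 2 *
        (‖u - u'‖ * Metric.diam O * (T.maxShadowEdgeLength ρ).toReal) := by
      have hd : (0 : ℝ) ≤ Metric.diam O := Metric.diam_nonneg
      positivity
    have h3 := mul_le_mul_of_nonneg_left (add_le_add h1 h2) (sq_nonneg (maxAlbedo O ρ))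
    have h4 := mul_le_mul_of_nonneg_right hsqrt hX
    linarith
  · refine (T.integral_surfaceMeasure_le hint (fun i => integrable_const _)
      fun i x hx => T.sq_direct_sub_direct_le_of_convex hconv hOc hρ u u' hx).trans_eq ?_
    simp_rw [integral_const, smul_eq_mul]
    rw [← Finset.sum_mul, ← T.area_eq]
    ring
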